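/- **Theorem (Linear-sized tree representation).** Let $G=(X,E)$ be a symmetric 2-structure, i.e. $X$ is a finite non-empty set and $E:X^2\to\mathbb N$ satisfies $E(x,y)=E(y,x)$. Let $K\subseteq\mathbb N$ be a set of colours containing $E(x,y)$ for all $x\ne y$ (for instance the set of all values of $E$), and let $\mathcal I:K\to K$ be an involution without fixed point. A set $U\subseteq X$ is an *involution module* if for all $s,v\in U$ either $N_s^i(X\setminus U)=N_v^{\mathcal I(i)}(X\setminus U)$ for all $i\in K$, or $N_s^i(X\setminus U)=N_v^{i}(X\setminus U)$ for all $i\in K$, where $N_s^i(A)=\{x\in A: E(s,x)=i\}$. Let $\mathcal F\subseteq 2^X$ be the family of involution modules of $G$. Then: 1. $\mathcal F$ is a partitive crossing family: $\emptyset,X\in\mathcal F$, and whenever $A,B\in\mathcal F$ are crossing (i.e. $A\cap B$, $A\setminus B$, $B\setminus A$ and $X\setminus(A\cup B)$ are all non-empty), the sets $A\cup B$, $A\cap B$, $A\setminus B$ and $A\bigtriangleup B$ belong to $\mathcal F$. 2. $\mathcal F$ has a tree-representation $T$ whose number of nodes plus number of arcs is at most $6|X|$, and it is unique: any other tree-representation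 of $\mathcal F$ is obtained from $T$ by an isomorphism of trees that fixes every leaf and preserves arcs and the labels of internal nodes. Here a *tree-representation* of a family $\mathcal F\subseteq 2^X$ is a finite unrooted tree whose leaves (the nodes with at most one neighbour) are exactly the elements of $X$ and whose internal nodes have at least three neighbours, in which every edge is directed one way or both ways, so as to form one or two arcs, and every internal node is labelled *complete* or *prime*. For adjacent nodes $M,N$ let $X_{M\to N}$ be the set of leaves whose path to $N$ traverses $M$. Call a node $M$ a *child* of the node $N$ if $(M,N)$ is an arc and $M$ is not the only out-neighbour of $N$. It is required that: * for adjacent nodes $M,N$, the pair $(M,N)$ is an arc if and only if $X_{M\to N}\in\mathcal F$; * an internal node $N$ with children $N_1,\dots,N_k$ is labelled complete if $\bigcup_{i\in I}X_{N_i\to N}\in\mathcal F$ for every $I\subseteq\{1,\dots,k\}$ with $1<|I|<k$, and prime otherwise; * the members of $\mathcal F$ are exactly $\emptyset$, $X$, the sets $X_{M\to N}$ for the arcs $(M,N)$, and the sets $\bigcup_{i\in I}X_{N_i\to N}$ for the complete nodes $N$ with children $N_1,\dots,N_k$ and $I\subseteq\{1,\dots,k\}$ with $1<|I|<k$. -/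

import Mathlib

universe u

/-- A symmetric 2-structure on the vertex set `X`. -/
structure TwoStructure (X : Type u) where
  E : X → X → ℕ
  symm : ∀ x y, E x y = E y x

/-- `G.N i s A` is the set of the elements of `A` that are connected to `s` with colour `i`. -/
def TwoStructure.N {X : Type u} (G : TwoStructure X) (i : ℕ) (s : X) (A : Set X) : Set X :=
  {x | x ∈ A ∧ G.E s x = i}

/-- `U` is an involution module of `G` with respect to the map `I` on the set of colours `K`. -/
def TwoStructure.IsInvolutionModule {X : Type u} (G : TwoStructure X) {K : Set ℕ} (I : K → K)
    (U : Set X) : Prop :=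
  ∀ s ∈ U, ∀ v ∈ U,
    (∀ i : K, G.N i s Uᶜ = G.N (I i) v Uᶜ) ∨ (∀ i : K, G.N i s Uᶜ = G.N i v Uᶜ)

/-- The family of all involution modules. -/
def TwoStructure.involutionModules {X : Type u} (G : TwoStructure X) {K : Set ℕ} (I : K → K) :
    Set (Set X) :=
  {U | G.IsInvolutionModule I U}

def Overlapping {X : Type u} (A B : Set X) : Prop :=
  (A ∩ B).Nonempty ∧ (A \ B).Nonempty ∧ (B \ A).Nonempty

def Crossing {X : Type u} (A B : Set X) : Prop :=
  Overlapping A B ∧ A ∪ B ≠ Set.univ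

structure IsPartitiveCrossing {X : Type u} (F : Set (Set X)) : Prop where
  empty_mem : ∅ ∈ F
  univ_mem : Set.univ ∈ F
  union_mem : ∀ A ∈ F, ∀ B ∈ F, Crossing A B → A ∪ B ∈ F
  inter_mem : ∀ A ∈ F, ∀ B ∈ F, Crossing A B → A ∩ B ∈ F
  diff_mem : ∀ A ∈ F, ∀ B ∈ F, Crossing A B → A \ B ∈ F
  symmDiff_mem : ∀ A ∈ F, ∀ B ∈ F, Crossing A B → symmDiff A B ∈ F

inductive NodeLabel where
  | complete
  | prime

/-- An unrooted directed tree whose leaves are the elements of `X`, whose internal nodes have at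
least three neighbours and carry a label (the label of a leaf is never used). Every edge of the
tree is directed in at least one of the two ways, possibly in both. -/
structure DirectedTree (X : Type u) where
  V : Type u
  finite : Finite V
  graph : SimpleGraph V
  isTree : graph.IsTree
  leaf : X → V
  leaf_injective : Function.Injective leaf
  leaf_degree : ∀ x, (graph.neighborSet (leaf x)).ncard ≤ 1
  internal_degree : ∀ v, v ∉ Set.range leaf → 3 ≤ (graph.neighborSet v).ncard
  Arc : V → V → Prop
  arc_adj : ∀ v w, Arc v w → graph.Adj v w
  adj_arc : ∀ v w, graph.Adj v w → Arc v w ∨ Arc w v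
  label : V → NodeLabel

namespace DirectedTree

variable {X : Type u}

/-- The set of the leaves whose paths to `v` traverse `w`. For adjacent `w`, `v` this is the set of
the leaves on the side of `w` of the edge between `w` and `v`. -/
def side (T : DirectedTree X) (w v : T.V) : Set X :=
  {x | ∃ p : T.graph.Walk (T.leaf x) v, p.IsPath ∧ w ∈ p.support}

def IsInternal (T : DirectedTree X) (v : T.V) : Prop := v ∉ Set.range T.leaf

/-- The children of `v`: its in-neighbours, except for the out-neighbour of `v` if `v` has exactly
one out-neighbour (this exception matters only when the edge to it is directed both ways). -/
def children (T : DirectedTree X) (v : T.V) : Set T.V :=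
  {w | T.Arc w v ∧ ¬ ∀ z, T.Arc v z ↔ z = w}

/-- `A` is the union of the leaf sets of more than one but not all of the children of `v`. -/
def IsChildUnion (T : DirectedTree X) (v : T.V) (A : Set X) : Prop :=
  ∃ I ⊆ T.children v, 1 < I.ncard ∧ I.ncard < (T.children v).ncard ∧ A = ⋃ w ∈ I, T.side w v

/-- `T` is a tree-representation of the family `F`. -/
structure Represents (T : DirectedTree X) (F : Set (Set X)) : Prop where
  arc_iff : ∀ v w, T.graph.Adj v w → (T.Arc v w ↔ T.side v w ∈ F)
  complete_iff : ∀ v, T.IsInternal v →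
    (T.label v = NodeLabel.complete ↔ ∀ A, T.IsChildUnion v A → A ∈ F)
  mem_iff : ∀ A, A ∈ F ↔ A = ∅ ∨ A = Set.univ ∨ (∃ v w, T.Arc v w ∧ A = T.side v w) ∨
    ∃ v, T.IsInternal v ∧ T.label v = NodeLabel.complete ∧ T.IsChildUnion v A

/-- The size of `T`: the number of its nodes plus the number of its arcs. -/
noncomputable def size (T : DirectedTree X) : ℕ :=
  Nat.card T.V + {a : T.V × T.V | T.Arc a.1 a.2}.ncard

/-- `T` and `T'` are the same up to renaming the internal nodes. -/
def IsIsomorphic (T T' : DirectedTree X) : Prop :=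
  ∃ φ : T.graph ≃g T'.graph, (∀ x, φ (T.leaf x) = T'.leaf x) ∧
    (∀ v w, T.Arc v w ↔ T'.Arc (φ v) (φ w)) ∧
    ∀ v, T.IsInternal v → T.label v = T'.label (φ v)

end DirectedTree

/-! Call a proper bipartition of `X` strong if one of its sides lies in the family and no member
crosses it (`IsStrongSplit`). The edges of any tree-representation are exactly the strong splits
(`Represents.isEdgeSide_iff`): every member is a union of branches at one node, so it crosses no
edge, while a set of children at a complete node is crossed by another such set unless it is itself
an edge side. A tree whose internal nodes have at least three neighbours is recovered from its edge
splits, and the family then dictates arcs and labels. This gives uniqueness.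

For existence, root at a leaf `r` and take the sides of strong splits that avoid `r`. They are
laminar, so their inclusion order has a tree as Hasse diagram. A member that is no edge side is a
union of branches at an internal node. Contracting the branches to points gives a crossing family on
the neighbours of that node in which every non-trivial member is crossed. Such a family contains all
non-empty sets of children, by `structure_of_nontrivial`; its core is that a partitive family whose
non-trivial members are all overlapped contains every pair as soon as it has one non-trivial member.

For involution modules, the relation between two vertices seen from outside is one bit, "apply the
involution or not". The bits commute, and since the involution has no fixed point a single colour
determines the bit. Apart from the crossing axioms, the tree argument uses that singletons are
members and the complement rule `compl_mem_involutionModules`. -/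

namespace SimpleGraph

/-! ### The domination order of a rooted tree -/

variable {V : Type*} {G : SimpleGraph V} {r u v w z : V}

/-- In the graph `G` rooted at `r`, the vertex `v` dominates `u`: every walk from `u` to `r`
traverses `v`. -/
def Below (G : SimpleGraph V) (r u v : V) : Prop :=
  ∀ p : G.Walk u r, v ∈ p.support

namespace Below

theorem refl (G : SimpleGraph V) (r u : V) : G.Below r u u := fun p => p.start_mem_support

theorem root (G : SimpleGraph V) (r u : V) : G.Below r u r := fun p => p.end_mem_support

theorem swap (h : G.Below r u v) : G.Below u r v := fun p => by
  simpa using h p.reverse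

theorem trans (h : G.Below r u v) (h' : G.Below r v w) : G.Below r u w := fun p => by
  classical
  exact p.support_dropUntil_subset_support (h p) (h' (p.dropUntil v (h p)))

theorem eq_root (h : G.Below r r v) : v = r := by
  simpa using h Walk.nil

theorem dist_lt (hG : G.Connected) (h : G.Below r u v) (hne : u ≠ v) :
    G.dist v r < G.dist u r := by
  classical
  obtain ⟨p, hp⟩ := hG.exists_walk_length_eq_dist u r
  have h1 := dist_le (p.dropUntil v (h p))
  have h2 := congrArg Walk.length (p.take_spec (h p))
  rw [Walk.length_append] at h2
  have h3 : (p.takeUntil v (h p)).length ≠ 0 := fun h0 => hne (Walk.eq_of_length_eq_zero h0)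
  omega

theorem antisymm (hG : G.Connected) (h : G.Below r u v) (h' : G.Below r v u) : u = v := by
  by_contra hne
  exact lt_asymm (h.dist_lt hG hne) (h'.dist_lt hG (Ne.symm hne))

/-- Follow a walk from `u` to the first of `v`, `w` that it meets, then continue to `r` along a walk
avoiding the other: this contradicts domination. -/
theorem total (hG : G.Connected) (h : G.Below r u v) (h' : G.Below r u w) :
    G.Below r v w ∨ G.Below r w v := by
  classical
  rcases eq_or_ne v w with rfl | hne
  · exact Or.inl (refl _ _ _)
  by_contra! hc
  simp only [Below, not_forall] at hc
  obtain ⟨⟨q, hq⟩, q', hq'⟩ := hc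
  obtain ⟨p⟩ := hG u r
  by_cases hw : w ∈ (p.takeUntil v (h p)).support
  · have hv := Walk.notMem_support_takeUntil_support_takeUntil_subset hne.symm (h p) hw
    have := h ((p.takeUntil w (h' p)).append q')
    rw [Walk.mem_support_append_iff] at this
    tauto
  · have := h' ((p.takeUntil v (h p)).append q)
    rw [Walk.mem_support_append_iff] at this
    tauto

theorem eq_of_adj (hG : G.Connected) (hv : G.Adj u v) (hw : G.Adj u w) (h : G.Below r u v)
    (h' : G.Below r u w) : v = w := by
  wlog hvw : G.Below r v w generalizing v w
  · exact (this hw hv h' h ((h'.total hG h).resolve_right hvw)).symm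
  by_contra hne
  have hn : ¬ G.Below r w v := fun hb => hne (hvw.antisymm hG hb)
  simp only [Below, not_forall] at hn
  obtain ⟨q, hq⟩ := hn
  have := h (Walk.cons hw q)
  rw [Walk.support_cons, List.mem_cons] at this
  rcases this with rfl | h
  · exact hv.ne rfl
  · exact hq h

theorem of_adj (hv : G.Adj u v) (hw : G.Below r u w)
    (hne : u ≠ w) : G.Below r v w := fun q => by
  have := hw (Walk.cons hv q)
  rw [Walk.support_cons, List.mem_cons] at this
  exact this.resolve_left hne.symm

end Below

theorem Adj.below_or (hG : G.IsTree) (h : G.Adj u v) (r : V) : G.Below r u v ∨ G.Below r v u := by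
  by_contra! hc
  simp only [Below, not_forall] at hc
  obtain ⟨⟨p, hp⟩, q, hq⟩ := hc
  have hb := isAcyclic_iff_forall_adj_isBridge.1 hG.isAcyclic h
  rw [isBridge_iff_forall_walk_mem_edges] at hb
  have := hb (p.append q.reverse)
  rw [Walk.edges_append, List.mem_append, Walk.edges_reverse, List.mem_reverse] at this
  rcases this with h | h
  · exact hp (p.snd_mem_support_of_mem_edges h)
  · exact hq (q.fst_mem_support_of_mem_edges h)

theorem IsTree.exists_parent (hG : G.IsTree) (h : u ≠ r) : ∃ v, G.Adj u v ∧ G.Below r u v := by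
  obtain ⟨p, hp⟩ := (hG.existsUnique_path u r).exists
  cases p with
  | nil => exact absurd rfl h
  | @cons _ v _ huv q =>
    refine ⟨v, huv, ?_⟩
    rw [Walk.cons_isPath_iff] at hp
    exact (huv.below_or hG r).resolve_right fun hb => hp.2 (hb q)

theorem Below.exists_child (hG : G.IsTree) (h : G.Below r u v) (hne : u ≠ v) :
    ∃ c, G.Adj c v ∧ G.Below r c v ∧ G.Below r u c := by
  induction hd : G.dist u r using Nat.strong_induction_on generalizing u with | _ d ih =>
  have hu : u ≠ r := by
    rintro rfl
    exact hne h.eq_root.symm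
  obtain ⟨p, hup, hp⟩ := hG.exists_parent hu
  have hpv := h.of_adj hup hne
  by_cases hpv' : p = v
  · subst hpv'
    exact ⟨u, hup, hp, refl _ _ _⟩
  · have := hp.dist_lt hG.connected hup.ne
    obtain ⟨c, h1, h2, h3⟩ := ih _ (hd ▸ this) hpv hpv' rfl
    exact ⟨c, h1, h2, hp.trans h3⟩

/-- Removing the edge to the parent cuts off the descendants. -/
theorem below_parent_iff (hG : G.IsTree) (huv : G.Adj u v) (h : G.Below r u v) :
    G.Below v z u ↔ G.Below r z u := by
  constructor
  · intro hz
    have hn : ¬ G.Below r v u := fun hb => huv.ne (h.antisymm hG.connected hb)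
    by_contra hc
    simp only [Below, not_forall] at hn hc
    obtain ⟨⟨q, hq⟩, p, hp⟩ := And.intro hn hc
    have := hz (p.append q.reverse)
    rw [Walk.mem_support_append_iff, Walk.support_reverse, List.mem_reverse] at this
    tauto
  · intro hz p
    have hn : ¬ G.Below r v u := fun hb => huv.ne (h.antisymm hG.connected hb)
    simp only [Below, not_forall] at hn
    obtain ⟨q, hq⟩ := hn
    have := hz (p.append q)
    rw [Walk.mem_support_append_iff] at this
    tauto

/-- By `swap`, both statements become comparisons of `u` and `v` in the tree rooted at `z`, and
exactly one end of an edge lies below the other. -/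
theorem Adj.below_iff_not (hG : G.IsTree) (huv : G.Adj u v) :
    G.Below u z v ↔ ¬ G.Below v z u := by
  constructor
  · intro h h'
    exact huv.ne (h'.swap.antisymm hG.connected h.swap).symm
  · intro h
    exact ((huv.below_or hG z).resolve_right fun hb => h hb.swap).swap

/-- The children of a vertex have disjoint sets of descendants. -/
theorem Below.eq_child (hG : G.Connected) (hu : G.Adj u v) (hw : G.Adj w v)
    (huv : G.Below r u v) (hwv : G.Below r w v) (h : G.Below r z u) (h' : G.Below r z w) :
    u = w := by
  wlog huw : G.Below r u w generalizing u w
  · exact (this hw hu hwv huv h' h ((h'.total hG h).resolve_right huw)).symm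
  by_contra hne
  exact hw.ne (hwv.antisymm hG (huw.of_adj hu hne))

theorem Below.iso {V' : Type*} {G' : SimpleGraph V'} (φ : G ≃g G') :
    G'.Below (φ r) (φ u) (φ v) ↔ G.Below r u v := by
  constructor
  · intro h p
    have := h (p.map φ.toHom)
    rw [Walk.support_map, List.mem_map] at this
    obtain ⟨a, ha, e⟩ := this
    rwa [φ.injective e] at ha
  · intro h p
    have := h ((p.map φ.symm.toHom).copy (φ.symm_apply_apply u) (φ.symm_apply_apply r))
    rw [Walk.support_copy, Walk.support_map, List.mem_map] at this
    obtain ⟨a, ha, e⟩ := this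
    rw [← e]
    simpa using ha

theorem mem_support_of_isTree (hG : G.IsTree) :
    (∃ p : G.Walk u v, p.IsPath ∧ w ∈ p.support) ↔ G.Below v u w := by
  classical
  constructor
  · rintro ⟨p, hp, hw⟩ q
    have := (hG.existsUnique_path u v).unique hp q.bypass_isPath
    subst this
    exact q.support_bypass_subset_support hw
  · intro h
    obtain ⟨p, hp⟩ := (hG.existsUnique_path u v).exists
    exact ⟨p, hp, h p⟩

end SimpleGraph

/-! ### Overlapping and crossing sets -/

theorem Overlapping.symm {X : Type u} {A B : Set X} (h : Overlapping A B) : Overlapping B A :=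
  ⟨Set.inter_comm A B ▸ h.1, h.2.2, h.2.1⟩

theorem Overlapping.left_nontrivial {X : Type u} {A B : Set X} (h : Overlapping A B) :
    A.Nontrivial := by
  obtain ⟨⟨x, hx⟩, ⟨y, hy⟩, -⟩ := h
  exact ⟨x, hx.1, y, hy.1, fun e => hy.2 (e ▸ hx.2)⟩

theorem Crossing.symm {X : Type u} {A B : Set X} (h : Crossing A B) : Crossing B A :=
  ⟨h.1.symm, Set.union_comm A B ▸ h.2⟩

theorem crossing_iff {X : Type u} {A B : Set X} :
    Crossing A B ↔ (∃ x ∈ A, x ∈ B) ∧ (∃ x ∈ A, x ∉ B) ∧ (∃ x ∉ A, x ∈ B) ∧ ∃ x ∉ A, x ∉ B := by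
  simp only [Crossing, Overlapping, Set.Nonempty, Set.mem_inter_iff, Set.mem_sdiff,
    Set.ne_univ_iff_exists_notMem, Set.mem_union, not_or]
  constructor
  · rintro ⟨⟨h1, h2, ⟨x, hx⟩⟩, h4⟩
    exact ⟨h1, h2, ⟨x, hx.2, hx.1⟩, h4⟩
  · rintro ⟨h1, h2, ⟨x, hx⟩, h4⟩
    exact ⟨⟨h1, h2, ⟨x, hx.2, hx.1⟩⟩, h4⟩

theorem crossing_compl_left {X : Type u} {A B : Set X} : Crossing Aᶜ B ↔ Crossing A B := by
  simp only [crossing_iff, Set.mem_compl_iff, not_not]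
  tauto

theorem crossing_compl_right {X : Type u} {A B : Set X} : Crossing A Bᶜ ↔ Crossing A B := by
  simp only [crossing_iff, Set.mem_compl_iff, not_not]
  tauto

/-- Used to obtain the complement of `A ∩ B` as the crossing union of `Aᶜ` and `symmDiff A B`. -/
theorem Crossing.symmDiff_right {X : Type u} {A B : Set X} (h : Crossing A B) :
    Crossing A (symmDiff A B) := by
  rw [crossing_iff] at h ⊢
  obtain ⟨⟨x, hx, hxB⟩, ⟨y, hy, hyB⟩, ⟨z, hz, hzB⟩, ⟨t, ht, htB⟩⟩ := h
  simp only [Set.mem_symmDiff]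
  exact ⟨⟨y, hy, Or.inl ⟨hy, hyB⟩⟩, ⟨x, hx, by tauto⟩, ⟨z, hz, Or.inr ⟨hzB, hz⟩⟩, ⟨t, ht, by tauto⟩⟩

theorem Crossing.compl_nontrivial {X : Type u} {A B : Set X} (h : Crossing A B) :
    Aᶜ.Nontrivial := (crossing_compl_left.2 h).1.left_nontrivial

/-- A partitive family of subsets of `Y` which contains the singletons of `Y` and in which every
non-trivial member is overlapped. -/
structure IsStronglyPartitive {N : Type u} (P : Set (Set N)) (Y : Set N) : Prop where
  sub : ∀ A ∈ P, A ⊆ Y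
  singleton : ∀ y ∈ Y, {y} ∈ P
  union : ∀ A ∈ P, ∀ B ∈ P, Overlapping A B → A ∪ B ∈ P
  inter : ∀ A ∈ P, ∀ B ∈ P, Overlapping A B → A ∩ B ∈ P
  diff : ∀ A ∈ P, ∀ B ∈ P, Overlapping A B → A \ B ∈ P
  symmDiff_mem : ∀ A ∈ P, ∀ B ∈ P, Overlapping A B → symmDiff A B ∈ P
  overlapped : ∀ A ∈ P, A.Nontrivial → A ≠ Y → ∃ B ∈ P, Overlapping A B

/-! ### Partitive families without non-trivial strong members -/

namespace IsStronglyPartitive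

variable {N : Type u} {P : Set (Set N)} {Y : Set N}

theorem mem_of_pairs [Finite N] (h : IsStronglyPartitive P Y) {T : Set N} (hTY : T ⊆ Y)
    (hT : T.Nonempty) (hp : ∀ x ∈ T, ∀ y ∈ T, x ≠ y → {x, y} ∈ P) : T ∈ P := by
  induction T, T.toFinite using Set.Finite.induction_on with
  | empty => exact absurd hT Set.not_nonempty_empty
  | @insert x T hx _ ih =>
    rcases T.eq_empty_or_nonempty with rfl | ⟨y, hy⟩
    · simpa using h.singleton x (hTY (by simp))
    have hxy : ({x, y} : Set N) ∈ P :=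
      hp x (Set.mem_insert _ _) y (Set.mem_insert_of_mem _ hy) (fun e => hx (e ▸ hy))
    by_cases hsub : T ⊆ {y}
    · have : T = {y} := hsub.antisymm (by simpa using hy)
      rwa [this]
    · have hTP := ih (fun z hz => hTY (Set.mem_insert_of_mem _ hz)) ⟨y, hy⟩
        fun a ha b hb => hp a (Set.mem_insert_of_mem _ ha) b (Set.mem_insert_of_mem _ hb)
      obtain ⟨z, hz, hzy⟩ := Set.not_subset.1 hsub
      have := h.union _ hTP _ hxy ⟨⟨y, hy, by simp⟩,
        ⟨z, hz, by
          simp only [Set.mem_insert_iff, Set.mem_singleton_iff, not_or]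
          exact ⟨fun e => hx (e ▸ hz), hzy⟩⟩, ⟨x, by simp, hx⟩⟩
      have e : T ∪ {x, y} = insert x T := by
        ext z
        simp only [Set.mem_union, Set.mem_insert_iff, Set.mem_singleton_iff]
        constructor
        · rintro (h | rfl | rfl) <;> tauto
        · tauto
      rwa [e] at this

theorem pair_trans (h : IsStronglyPartitive P Y) {a b c : N} (hac : a ≠ c) (hab : a ≠ b)
    (hbc : b ≠ c) (h1 : {a, b} ∈ P) (h2 : {b, c} ∈ P) : {a, c} ∈ P := by
  have := h.symmDiff_mem _ h1 _ h2 ⟨⟨b, by simp, by simp⟩, ⟨a, by simp, by simp [hac, hab]⟩,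
    ⟨c, by simp, by simp [hac.symm, hbc.symm]⟩⟩
  have e : symmDiff ({a, b} : Set N) {b, c} = {a, c} := by
    ext z
    simp only [Set.mem_symmDiff, Set.mem_insert_iff, Set.mem_singleton_iff]
    grind
  rwa [e] at this

/-- Some member `C` overlaps `A \ {a}`; whichever of `A ∩ C` and `A \ C` contains `a` will do. -/
theorem exists_smaller (h : IsStronglyPartitive P Y) {A : Set N} {a : N} (hA : A ∈ P) (ha : a ∈ A)
    (hZ : A \ {a} ∈ P) (hZn : (A \ {a}).Nontrivial) :
    ∃ A' ∈ P, a ∈ A' ∧ A' ⊂ A ∧ A'.Nontrivial := by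
  have hY : A \ {a} ≠ Y := fun e => by
    have : a ∈ A \ {a} := e ▸ h.sub A hA ha
    exact this.2 rfl
  obtain ⟨C, hC, ⟨x, hxZ, hxC⟩, ⟨y, hyZ, hyC⟩, ⟨z, hzC, hzZ⟩⟩ := h.overlapped _ hZ hZn hY
  by_cases haC : a ∈ C
  · refine ⟨A ∩ C, ?_, ⟨ha, haC⟩, ⟨Set.inter_subset_left, fun hs => hyC (hs hyZ.1).2⟩,
      ⟨a, ⟨ha, haC⟩, x, ⟨hxZ.1, hxC⟩, fun e => hxZ.2 e.symm⟩⟩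
    by_cases hCA : C ⊆ A
    · rwa [Set.inter_eq_right.2 hCA]
    · obtain ⟨t, ht, htA⟩ := Set.not_subset.1 hCA
      exact h.inter _ hA _ hC ⟨⟨a, ha, haC⟩, ⟨y, hyZ.1, hyC⟩, ⟨t, ht, htA⟩⟩
  · refine ⟨A \ C, ?_, ⟨ha, haC⟩, ⟨Set.sdiff_subset, fun hs => (hs hxZ.1).2 hxC⟩,
      ⟨a, ⟨ha, haC⟩, y, ⟨hyZ.1, hyC⟩, fun e => hyZ.2 e.symm⟩⟩
    exact h.diff _ hA _ hC ⟨⟨x, hxZ.1, hxC⟩, ⟨y, hyZ.1, hyC⟩,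
      ⟨z, hzC, fun hz => hzZ ⟨hz, fun e => haC (e ▸ hzC)⟩⟩⟩

theorem exists_pair [Finite N] (h : IsStronglyPartitive P Y)
    (hex : ∃ A ∈ P, A.Nontrivial ∧ A ≠ Y) {a : N} (ha : a ∈ Y) : ∃ b, b ≠ a ∧ {a, b} ∈ P := by
  -- If a maximal non-trivial proper member misses `a`, its union with an overlapping member is `Y`,
  -- so that other member contains `a`.
  have hex' : ∃ A, A ∈ P ∧ A.Nontrivial ∧ A ≠ Y ∧ a ∈ A := by
    obtain ⟨M, hM⟩ := exists_maximal_of_wellFoundedGT (fun A => A ∈ P ∧ A.Nontrivial ∧ A ≠ Y) hex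
    by_cases haM : a ∈ M
    · exact ⟨M, hM.prop.1, hM.prop.2.1, hM.prop.2.2, haM⟩
    obtain ⟨B, hB, ho⟩ := h.overlapped M hM.prop.1 hM.prop.2.1 hM.prop.2.2
    have hU : M ∪ B = Y := by
      by_contra hne
      have := hM.le_of_ge ⟨h.union _ hM.prop.1 _ hB ho,
        hM.prop.2.1.mono Set.subset_union_left, hne⟩ Set.subset_union_left
      obtain ⟨x, hx, hxM⟩ := ho.2.2
      exact hxM (this (Or.inr hx))
    refine ⟨B, hB, ho.symm.left_nontrivial, ?_, ?_⟩
    · rintro rfl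
      obtain ⟨x, hx, hxB⟩ := ho.2.1
      exact hxB (hU ▸ Or.inl hx)
    · rw [← hU] at ha
      exact ha.resolve_left haM
  obtain ⟨A, hA⟩ := exists_minimal_of_wellFoundedLT _ hex'
  obtain ⟨hAP, hAn, hAY, haA⟩ := hA.prop
  have hmin : ∀ A' ∈ P, a ∈ A' → A' ⊂ A → ¬ A'.Nontrivial := fun A' h1 h2 h3 h4 =>
    h3.2 (hA.le_of_le ⟨h1, h4, fun e => h3.2 (e ▸ h.sub A hAP), h2⟩ h3.1)
  -- An overlapping member cuts the minimal `A` in two members; the part containing `a` must be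
  -- `{a}`, so the other part is `A \ {a}`.
  have key : ∀ A₁ : Set N, A₁ ⊂ A → a ∈ A₁ → A₁ ∈ P → A \ A₁ ∈ P → A \ {a} ∈ P := by
    intro A₁ h1 h2 h3 h4
    have : A₁ = {a} := (Set.not_nontrivial_iff.1 (hmin _ h3 h2 h1)).eq_singleton_of_mem h2
    rwa [this] at h4
  have hdiff : A \ {a} ∈ P := by
    obtain ⟨B, hB, ho⟩ := h.overlapped A hAP hAn hAY
    have h1 := h.inter _ hAP _ hB ho
    have h2 := h.diff _ hAP _ hB ho
    obtain ⟨⟨x, hx⟩, ⟨y, hy⟩, -⟩ := ho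
    by_cases haB : a ∈ B
    · refine key (A ∩ B) ⟨Set.inter_subset_left, fun hs => hy.2 (hs hy.1).2⟩ ⟨haA, haB⟩ h1 ?_
      rwa [Set.sdiff_self_inter]
    · refine key (A \ B) ⟨Set.sdiff_subset, fun hs => (hs hx.1).2 hx.2⟩ ⟨haA, haB⟩ h2 ?_
      rwa [Set.sdiff_sdiff_right_self]
  have hsub : ¬ (A \ {a}).Nontrivial := fun hn => by
    obtain ⟨A', h1, h2, h3, h4⟩ := h.exists_smaller hAP haA hdiff hn
    exact hmin A' h1 h2 h3 h4
  obtain ⟨b, hbA, hba⟩ := hAn.exists_ne a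
  refine ⟨b, hba, ?_⟩
  have : A \ {a} = {b} := (Set.not_nontrivial_iff.1 hsub).eq_singleton_of_mem ⟨hbA, hba⟩
  have e : A = {a, b} := by
    rw [← Set.insert_sdiff_self_of_mem haA, this]
  rwa [← e]

theorem pair_mem [Finite N] (h : IsStronglyPartitive P Y)
    (hex : ∃ A ∈ P, A.Nontrivial ∧ A ≠ Y) {a b : N} (ha : a ∈ Y) (hb : b ∈ Y) (hab : a ≠ b) :
    {a, b} ∈ P := by
  -- By `pair_trans`, being joined by a pair in `P` is an equivalence; `Q` is the class of `a`, and
  -- it is a member. If it were not `Y`, a minimal member overlapping it would be a pair leaving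
  -- `Q`.
  set Q : Set N := {c | c = a ∨ {a, c} ∈ P} with hQ
  have haQ : a ∈ Q := Or.inl rfl
  have hQY : Q ⊆ Y := by
    rintro c (rfl | hc)
    · exact ha
    · exact h.sub _ hc (by simp)
  have hpair : ∀ x ∈ Q, ∀ y ∈ Q, x ≠ y → {x, y} ∈ P := by
    rintro x (rfl | hx) y (rfl | hy) hxy
    · exact absurd rfl hxy
    · exact hy
    · rwa [Set.pair_comm]
    · rcases eq_or_ne x a with rfl | hxa
      · exact hy
      rcases eq_or_ne y a with rfl | hya
      · rwa [Set.pair_comm]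
      · rw [Set.pair_comm] at hx
        exact h.pair_trans hxy hxa hya.symm hx hy
  have hclosed : ∀ q ∈ Q, ∀ c, q ≠ c → {q, c} ∈ P → c ∈ Q := by
    intro q hq c hqc hc
    rcases eq_or_ne c a with rfl | hca
    · exact Or.inl rfl
    rcases eq_or_ne q a with rfl | hqa
    · exact Or.inr hc
    · exact Or.inr (h.pair_trans hca.symm hqa.symm hqc (hpair _ haQ _ hq hqa.symm) hc)
  have hQP : Q ∈ P := h.mem_of_pairs hQY ⟨a, haQ⟩ hpair
  have hQn : Q.Nontrivial := by
    obtain ⟨c, hca, hc⟩ := h.exists_pair hex ha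
    exact ⟨a, haQ, c, Or.inr hc, hca.symm⟩
  suffices hQe : Q = Y by
    rw [← hQe] at hb
    exact hb.resolve_left hab.symm
  by_contra hne
  obtain ⟨A, hA⟩ := exists_minimal_of_wellFoundedLT (fun A => A ∈ P ∧ Overlapping Q A)
    (by simpa using h.overlapped Q hQP hQn hne)
  obtain ⟨hAP, ⟨q, hqQ, hqA⟩, ⟨q', hqQ', hqA'⟩, ⟨r, hrA, hrQ⟩⟩ := hA.prop
  have hmin : ∀ A' ∈ P, A' ⊂ A → ¬ Overlapping Q A' := fun A' h1 h2 h3 =>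
    h2.2 (hA.le_of_le ⟨h1, h3⟩ h2.1)
  -- A second common element `q₂` could be removed from `A` by subtracting the pair `{q₂, q'}`,
  -- against minimality.
  have hsingle : ∀ q₂ ∈ Q, q₂ ∈ A → q₂ = q := by
    intro q₂ h1 h2
    by_contra h3
    have hp := hpair _ h1 _ hqQ' (fun e => hqA' (e ▸ h2))
    have hqq' : q ≠ q' := fun e => hqA' (e ▸ hqA)
    have hrq : r ≠ q₂ := fun e => hrQ (e ▸ h1)
    have hrq' : r ≠ q' := fun e => hrQ (e ▸ hqQ')
    have := h.diff _ hAP _ hp ⟨⟨q₂, h2, by simp⟩, ⟨q, hqA, by simp [hqq', Ne.symm h3]⟩,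
      ⟨q', by simp, hqA'⟩⟩
    refine hmin _ this ⟨Set.sdiff_subset, fun hs => (hs h2).2 (by simp)⟩ ⟨⟨q, hqQ, hqA, ?_⟩,
      ⟨q', hqQ', fun hx => hqA' hx.1⟩, ⟨r, ⟨hrA, ?_⟩, hrQ⟩⟩
    · simp [hqq', Ne.symm h3]
    · simp [hrq, hrq']
  have hAQ : A \ Q = A \ {q} := by
    ext x
    simp only [Set.mem_sdiff, Set.mem_singleton_iff]
    constructor
    · rintro ⟨h1, h2⟩
      exact ⟨h1, fun e => h2 (e ▸ hqQ)⟩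
    · rintro ⟨h1, h2⟩
      exact ⟨h1, fun e => h2 (hsingle x e h1)⟩
  have hd : A \ {q} ∈ P := hAQ ▸ h.diff _ hAP _ hQP hA.prop.2.symm
  have hrA' : r ∈ A \ {q} := hAQ ▸ ⟨hrA, hrQ⟩
  by_cases hn : (A \ {q}).Nontrivial
  · obtain ⟨A', h1, h2, h3, h4⟩ := h.exists_smaller hAP hqA hd hn
    obtain ⟨c, hc, hcq⟩ := h4.exists_ne q
    exact hmin A' h1 h3 ⟨⟨q, hqQ, h2⟩, ⟨q', hqQ', fun hx => hqA' (h3.1 hx)⟩,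
      ⟨c, hc, fun hcQ => hcq (hsingle c hcQ (h3.1 hc))⟩⟩
  · have e := (Set.not_nontrivial_iff.1 hn).eq_singleton_of_mem hrA'
    have : A = {q, r} := by
      rw [← Set.insert_sdiff_self_of_mem hqA, e]
    exact hrQ (hclosed q hqQ r (fun e => hrQ (e ▸ hqQ)) (this ▸ hAP))

/-- A partitive family without non-trivial strong members contains either all sets, or only the
trivial ones. -/
theorem mem [Finite N] (h : IsStronglyPartitive P Y) (hex : ∃ A ∈ P, A.Nontrivial ∧ A ≠ Y)
    {T : Set N} (hTY : T ⊆ Y) (hT : T.Nonempty) : T ∈ P :=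
  h.mem_of_pairs hTY hT fun _ hx _ hy hxy => h.pair_mem hex (hTY hx) (hTY hy) hxy

end IsStronglyPartitive

/-! ### Crossing families on the neighbours of a node -/

namespace IsPartitiveCrossing

variable {N : Type u} {H : Set (Set N)}

/-- Applied to the map sending each leaf to the branch at a fixed node that contains it. -/
theorem preimage {X : Type u} {F : Set (Set X)} (hF : IsPartitiveCrossing F) {f : X → N}
    (hf : Function.Surjective f) : IsPartitiveCrossing {J | f ⁻¹' J ∈ F} := by
  have hcr : ∀ A B : Set N, Crossing A B → Crossing (f ⁻¹' A) (f ⁻¹' B) := by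
    intro A B h
    rw [crossing_iff] at h ⊢
    simpa only [hf.exists, Set.mem_preimage] using h
  exact
    { empty_mem := hF.empty_mem
      univ_mem := hF.univ_mem
      union_mem := fun A hA B hB h => hF.union_mem _ hA _ hB (hcr A B h)
      inter_mem := fun A hA B hB h => hF.inter_mem _ hA _ hB (hcr A B h)
      diff_mem := fun A hA B hB h => hF.diff_mem _ hA _ hB (hcr A B h)
      symmDiff_mem := fun A hA B hB h => hF.symmDiff_mem _ hA _ hB (hcr A B h) }

/-- Overlapping sets that avoid a common point `w` cross, so the members avoiding `w` form a
strongly partitive family on the complement of `w`. -/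
theorem mem_of_subset_compl_singleton [Finite N] (hF : IsPartitiveCrossing H) {w : N}
    (hs : ∀ i, i ≠ w → {i} ∈ H)
    (hcr : ∀ I ∈ H, w ∉ I → I.Nontrivial → Iᶜ.Nontrivial → ∃ J ∈ H, w ∉ J ∧ Crossing I J)
    (hex : ∃ I ∈ H, w ∉ I ∧ I.Nontrivial ∧ Iᶜ.Nontrivial) {A : Set N} (hwA : w ∉ A)
    (hA : A.Nonempty) : A ∈ H := by
  have cross : ∀ A B : Set N, w ∉ A → w ∉ B → Overlapping A B → Crossing A B := by
    intro A B hA hB h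
    refine ⟨h, fun e => ?_⟩
    have : w ∈ A ∪ B := e ▸ Set.mem_univ w
    exact this.elim hA hB
  have key : IsStronglyPartitive {J | J ∈ H ∧ w ∉ J} {w}ᶜ :=
    { sub := fun A hA x hx e => hA.2 (e ▸ hx)
      singleton := fun y hy => ⟨hs y hy, fun e => hy e.symm⟩
      union := fun A hA B hB h =>
        ⟨hF.union_mem _ hA.1 _ hB.1 (cross A B hA.2 hB.2 h), fun e => e.elim hA.2 hB.2⟩
      inter := fun A hA B hB h =>
        ⟨hF.inter_mem _ hA.1 _ hB.1 (cross A B hA.2 hB.2 h), fun e => hA.2 e.1⟩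
      diff := fun A hA B hB h =>
        ⟨hF.diff_mem _ hA.1 _ hB.1 (cross A B hA.2 hB.2 h), fun e => hA.2 e.1⟩
      symmDiff_mem := fun A hA B hB h =>
        ⟨hF.symmDiff_mem _ hA.1 _ hB.1 (cross A B hA.2 hB.2 h), fun e =>
          e.elim (fun e => hA.2 e.1) fun e => hB.2 e.1⟩
      overlapped := fun A hA hAn hne => by
        have hc : Aᶜ.Nontrivial := by
          by_contra hc
          exact hne (by
            rw [← (Set.not_nontrivial_iff.1 hc).eq_singleton_of_mem hA.2, compl_compl])
        obtain ⟨J, hJ, hwJ, h⟩ := hcr A hA.1 hA.2 hAn hc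
        exact ⟨J, ⟨hJ, hwJ⟩, h.1⟩ }
  obtain ⟨I, hI, hwI, hIn, hIc⟩ := hex
  refine (key.mem ⟨I, ⟨hI, hwI⟩, hIn, fun e => ?_⟩ (fun x hx e => hwA (e ▸ hx)) hA).1
  rw [e, compl_compl] at hIc
  exact Set.not_nontrivial_singleton hIc

/-- If some non-trivial member has its complement in the family, then all sets are members. -/
theorem forall_mem_of_compl [Finite N] (hF : IsPartitiveCrossing H)
    (hc : ∀ A D : Set N, A.Nonempty → A ⊆ D → D ∈ H → Aᶜ ∈ H → Dᶜ ∈ H)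
    (hcr : ∀ I ∈ H, I.Nontrivial → Iᶜ.Nontrivial → ∃ J ∈ H, Crossing I J)
    (hex : ∃ I ∈ H, Iᶜ ∈ H ∧ I.Nontrivial ∧ Iᶜ.Nontrivial) (A : Set N) : A ∈ H := by
  -- Take a minimal `D` containing `a` such that `D` and its complement are non-trivial members. A
  -- crossing member `J` splits `D`, and the complements of both parts are members too, so the part
  -- containing `a` is `{a}`.
  have hsing : ∀ a : N, {a} ∈ H ∧ ({a} : Set N)ᶜ ∈ H := by
    intro a
    have hex' : ∃ I, I ∈ H ∧ Iᶜ ∈ H ∧ I.Nontrivial ∧ Iᶜ.Nontrivial ∧ a ∈ I := by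
      obtain ⟨I, h1, h2, h3, h4⟩ := hex
      by_cases ha : a ∈ I
      · exact ⟨I, h1, h2, h3, h4, ha⟩
      · exact ⟨Iᶜ, h2, by rwa [compl_compl], h4, by rwa [compl_compl], ha⟩
    obtain ⟨D, hD⟩ := exists_minimal_of_wellFoundedLT _ hex'
    obtain ⟨h1, h2, h3, h4, ha⟩ := hD.prop
    obtain ⟨J, hJ, hcJ⟩ := hcr D h1 h3 h4
    have hcJ' := crossing_compl_left.2 hcJ
    have hsd := hF.symmDiff_mem _ h1 _ hJ hcJ
    have key : ∀ D' : Set N, D' ⊂ D → a ∈ D' → D' ∈ H → D'ᶜ ∈ H →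
        {a} ∈ H ∧ ({a} : Set N)ᶜ ∈ H := by
      intro D' k1 k2 k3 k4
      have : ¬ D'.Nontrivial := fun hn =>
        k1.2 (hD.le_of_le ⟨k3, k4, hn, h4.mono (Set.compl_subset_compl.2 k1.1), k2⟩ k1.1)
      rw [← (Set.not_nontrivial_iff.1 this).eq_singleton_of_mem k2]
      exact ⟨k3, k4⟩
    have hcE' := crossing_compl_left.2 hcJ.symmDiff_right
    obtain ⟨⟨x, hx, hxJ⟩, ⟨y, hy, hyJ⟩, -⟩ := crossing_iff.1 hcJ
    by_cases haJ : a ∈ J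
    · refine key (D ∩ J) ⟨Set.inter_subset_left, fun hs => hyJ (hs hy).2⟩ ⟨ha, haJ⟩
        (hF.inter_mem _ h1 _ hJ hcJ) ?_
      have := hF.union_mem _ h2 _ hsd hcE'
      have e : Dᶜ ∪ symmDiff D J = (D ∩ J)ᶜ := by
        ext z
        simp only [Set.mem_union, Set.mem_compl_iff, Set.mem_symmDiff, Set.mem_inter_iff]
        tauto
      rwa [e] at this
    · refine key (D \ J) ⟨Set.sdiff_subset, fun hs => (hs hx).2 hxJ⟩ ⟨ha, haJ⟩
        (hF.diff_mem _ h1 _ hJ hcJ) ?_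
      have := hF.union_mem _ h2 _ hJ hcJ'
      have e : Dᶜ ∪ J = (D \ J)ᶜ := by
        ext z
        simp only [Set.mem_union, Set.mem_compl_iff, Set.mem_sdiff]
        tauto
      rwa [e] at this
  have hcompl : ∀ D ∈ H, D.Nonempty → Dᶜ ∈ H := fun D hD ⟨a, ha⟩ =>
    hc {a} D (Set.singleton_nonempty a) (by simpa using ha) hD (hsing a).2
  obtain ⟨I, h1, h2, h3, h4⟩ := hex
  obtain ⟨w, hw⟩ := h4.nonempty
  have key : ∀ B : Set N, w ∉ B → B.Nonempty → B ∈ H := fun B hB hB' => by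
    refine hF.mem_of_subset_compl_singleton (fun i _ => (hsing i).1) ?_ ⟨I, h1, hw, h3, h4⟩ hB hB'
    intro I hI hwI hIn hIc
    obtain ⟨J, hJ, hcJ⟩ := hcr I hI hIn hIc
    -- Complementing does not affect crossing, so the crossing member can be chosen to avoid `w`.
    by_cases hwJ : w ∈ J
    · exact ⟨Jᶜ, hcompl J hJ ⟨w, hwJ⟩, fun h => h hwJ, crossing_compl_right.2 hcJ⟩
    · exact ⟨J, hJ, hwJ, hcJ⟩
  by_cases hwA : w ∈ A
  · rcases Set.eq_empty_or_nonempty Aᶜ with h | h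
    · rw [Set.compl_empty_iff.1 h]
      exact hF.univ_mem
    · rw [← compl_compl A]
      exact hcompl _ (key _ (fun h => h hwA) h) h
  · rcases A.eq_empty_or_nonempty with rfl | h
    · exact hF.empty_mem
    · exact key A hwA h

/-- The structure of the family at a node of the tree: if it has a non-trivial member, then every
such member consists of children, and all sets of children are members. -/
theorem structure_of_nontrivial [Finite N] (hF : IsPartitiveCrossing H)
    (hs : ∀ i : N, {i} ∈ H ∨ ({i} : Set N)ᶜ ∈ H)
    (hc : ∀ A D : Set N, A.Nonempty → A ⊆ D → D ∈ H → Aᶜ ∈ H → Dᶜ ∈ H)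
    (hcr : ∀ I ∈ H, I.Nontrivial → Iᶜ.Nontrivial → ∃ J ∈ H, Crossing I J)
    {I : Set N} (hI : I ∈ H) (hIn : I.Nontrivial) (hIc : Iᶜ.Nontrivial) :
    I ⊂ {i | {i} ∈ H ∧ ¬ ∀ j, ({j} : Set N)ᶜ ∈ H ↔ j = i} ∧
      ∀ J : Set N, J ⊆ {i | {i} ∈ H ∧ ¬ ∀ j, ({j} : Set N)ᶜ ∈ H ↔ j = i} → J.Nonempty → J ∈ H := by
  -- Here `{i} ∈ H` encodes an arc from `i` to the node and `{j}ᶜ ∈ H` an arc from the node to `j`;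
  -- the set in the conclusion is that of the children. If the test succeeds, every neighbour is a
  -- child.
  by_cases hex : ∃ I ∈ H, Iᶜ ∈ H ∧ I.Nontrivial ∧ Iᶜ.Nontrivial
  · have hall := hF.forall_mem_of_compl hc hcr hex
    have e : {i | {i} ∈ H ∧ ¬ ∀ j, ({j} : Set N)ᶜ ∈ H ↔ j = i} = Set.univ := by
      refine Set.eq_univ_of_forall fun i => ⟨hall _, fun h => ?_⟩
      obtain ⟨x, -, y, -, hxy⟩ := hIn
      exact hxy (((h x).1 (hall _)).trans ((h y).1 (hall _)).symm)
    rw [e]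
    refine ⟨⟨Set.subset_univ _, fun h => ?_⟩, fun J _ _ => hall J⟩
    obtain ⟨x, hx⟩ := hIc.nonempty
    exact hx (h (Set.mem_univ x))
  -- Otherwise the complement rule keeps non-trivial members away from every out-neighbour. A
  -- maximal one together with a member crossing it covers all but one point `w`, which is therefore
  -- the only out-neighbour; the children are all the others.
  · have avoid : ∀ w : N, ({w} : Set N)ᶜ ∈ H → ∀ J ∈ H, J.Nontrivial → Jᶜ.Nontrivial → w ∉ J :=
      fun w hw J hJ h1 h2 hwJ => hex ⟨J, hJ, hc {w} J (Set.singleton_nonempty w)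
        (by simpa using hwJ) hJ hw, h1, h2⟩
    obtain ⟨M, hM⟩ := exists_maximal_of_wellFoundedGT
      (fun J => J ∈ H ∧ J.Nontrivial ∧ Jᶜ.Nontrivial) ⟨I, hI, hIn, hIc⟩
    obtain ⟨hMH, hMn, hMc⟩ := hM.prop
    obtain ⟨B, hB, hcB⟩ := hcr M hMH hMn hMc
    obtain ⟨w, hw⟩ := Set.nonempty_compl.2 hcB.2
    have hU := hF.union_mem _ hMH _ hB hcB
    have hUc : ¬ (M ∪ B)ᶜ.Nontrivial := fun hn => by
      have := hM.le_of_ge ⟨hU, hMn.mono Set.subset_union_left, hn⟩ Set.subset_union_left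
      obtain ⟨x, hx, hxM⟩ := hcB.1.2.2
      exact hxM (this (Or.inr hx))
    have hUw := (Set.not_nontrivial_iff.1 hUc).eq_singleton_of_mem hw
    have hwH : ({w} : Set N)ᶜ ∈ H := by
      rw [← hUw, compl_compl]
      exact hU
    have huniq : ∀ j : N, ({j} : Set N)ᶜ ∈ H ↔ j = w := by
      refine fun j => ⟨fun hj => ?_, fun e => e ▸ hwH⟩
      by_contra hne
      have : j ∈ M ∪ B := by
        by_contra h
        have h' : j ∈ (M ∪ B)ᶜ := h
        rw [hUw] at h'
        exact hne h'
      rcases this with h | h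
      · exact avoid j hj M hMH hMn hMc h
      · exact avoid j hj B hB hcB.1.symm.left_nontrivial hcB.symm.compl_nontrivial h
    have hsing : ∀ i, i ≠ w → {i} ∈ H := fun i hi =>
      (hs i).resolve_right fun h => hi ((huniq i).1 h)
    have e : {i | {i} ∈ H ∧ ¬ ∀ j, ({j} : Set N)ᶜ ∈ H ↔ j = i} = {w}ᶜ := by
      ext i
      simp only [huniq, Set.mem_ofPred_eq, Set.mem_compl_iff, Set.mem_singleton_iff]
      constructor
      · rintro ⟨-, h⟩ rfl
        exact h fun j => Iff.rfl
      · exact fun h => ⟨hsing i h, fun h' => h ((h' w).1 rfl).symm⟩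
    rw [e]
    have hwI := avoid w hwH I hI hIn hIc
    refine ⟨⟨fun x hx e => hwI (e ▸ hx), fun h => ?_⟩, fun J hJ hJn => ?_⟩
    · refine Set.not_nontrivial_singleton (x := w) (hIc.mono ?_)
      rwa [Set.compl_subset_comm]
    · refine hF.mem_of_subset_compl_singleton hsing ?_ ⟨I, hI, hwI, hIn, hIc⟩
        (fun h => hJ h rfl) hJn
      intro A hA _ hAn hAc
      obtain ⟨J, hJ, hcJ⟩ := hcr A hA hAn hAc
      exact ⟨J, hJ, avoid w hwH J hJ hcJ.1.symm.left_nontrivial hcJ.symm.compl_nontrivial, hcJ⟩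

end IsPartitiveCrossing

/-! ### The involution modules -/

namespace TwoStructure

variable {X : Type u} {K : Set ℕ}

open Classical in
/-- The involution `I`, extended to all colours by the identity, or the identity, according to the
value of `b`. -/
noncomputable def twist (I : K → K) (b : Bool) (n : ℕ) : ℕ :=
  if h : n ∈ K ∧ b = true then I ⟨n, h.1⟩ else n

theorem twist_false (I : K → K) (n : ℕ) : twist I false n = n := by
  simp [twist]

theorem twist_true (I : K → K) (i : K) : twist I true i = I i := by
  simp [twist]

theorem twist_twist {I : K → K} (hI : Function.Involutive I) (b c : Bool) (n : ℕ) :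
    twist I b (twist I c n) = twist I (b ^^ c) n := by
  by_cases hn : n ∈ K
  · lift n to K using hn
    cases b <;> cases c <;> simp [twist_true, twist_false, hI n]
  · simp [twist, hn]

theorem twist_self {I : K → K} (hI : Function.Involutive I) (b : Bool) (n : ℕ) :
    twist I b (twist I b n) = n := by
  rw [twist_twist hI, Bool.xor_self, twist_false]

/-- The only place where the absence of fixed points enters: one colour determines the bit. -/
theorem twist_injective {I : K → K} (hfix : ∀ i, I i ≠ i) {b c : Bool} {n : ℕ} (hn : n ∈ K)
    (h : twist I b n = twist I c n) : b = c := by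
  lift n to K using hn
  have hne : (I n : ℕ) ≠ n := fun e => hfix n (Subtype.ext e)
  cases b <;> cases c <;> simp_all [twist_true, twist_false, eq_comm]

variable (G : TwoStructure X) {I : K → K}

theorem mem_involutionModules_iff (hK : ∀ x y, x ≠ y → G.E x y ∈ K) (hI : Function.Involutive I)
    {U : Set X} : U ∈ G.involutionModules I ↔
      ∀ s ∈ U, ∀ v ∈ U, ∃ b, ∀ x ∉ U, G.E v x = twist I b (G.E s x) := by
  refine forall₂_congr fun s hs => forall₂_congr fun v hv => ?_
  rw [Bool.exists_bool, or_comm]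
  refine or_congr ⟨fun h x hx => ?_, fun h i => ?_⟩ ⟨fun h x hx => ?_, fun h i => ?_⟩
  · have hk := hK s x (fun e => hx (e ▸ hs))
    have : x ∈ G.N (⟨_, hk⟩ : K) s Uᶜ := ⟨hx, rfl⟩
    rw [h] at this
    rw [twist_false, this.2]
  · ext x
    refine and_congr_right fun hx => ?_
    rw [h x hx, twist_false]
  · have hk := hK s x (fun e => hx (e ▸ hs))
    have : x ∈ G.N (⟨_, hk⟩ : K) s Uᶜ := ⟨hx, rfl⟩
    rw [h] at this
    rw [this.2, ← twist_true]
  · ext x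
    refine and_congr_right fun hx => ?_
    have hk := hK s x (fun e => hx (e ▸ hs))
    rw [h x hx]
    rw [show G.E s x = ((⟨_, hk⟩ : K) : ℕ) from rfl, twist_true, SetCoe.ext_iff, SetCoe.ext_iff]
    exact hI.injective.eq_iff.symm

theorem singleton_mem_involutionModules (I : K → K) (x : X) : {x} ∈ G.involutionModules I := by
  rintro s rfl v rfl
  exact Or.inr fun i => rfl

/-- Two vertices outside `D` differ by a bit `b` as seen from `a ∈ A`. Moving from `a` to `x ∈ D`
twists both colours by the same bit, which commutes with `b`. -/
theorem compl_mem_involutionModules (hK : ∀ x y, x ≠ y → G.E x y ∈ K)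
    (hI : Function.Involutive I) {A D : Set X} (hA : A.Nonempty) (hAD : A ⊆ D)
    (hD : D ∈ G.involutionModules I) (hAc : Aᶜ ∈ G.involutionModules I) :
    Dᶜ ∈ G.involutionModules I := by
  rw [mem_involutionModules_iff G hK hI] at *
  intro s hs v hv
  obtain ⟨a, ha⟩ := hA
  obtain ⟨b, hb⟩ := hAc s (fun h => hs (hAD h)) v (fun h => hv (hAD h))
  refine ⟨b, fun x hx => ?_⟩
  obtain ⟨d, hd⟩ := hD a (hAD ha) x (not_not.1 hx)
  rw [G.symm v x, hd v hv, G.symm a v, hb a (not_not.2 ha), G.symm s x, hd s hs, G.symm a s,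
    twist_twist hI, twist_twist hI, Bool.xor_comm]

theorem isPartitiveCrossing_involutionModules (hK : ∀ x y, x ≠ y → G.E x y ∈ K)
    (hI : Function.Involutive I) (hfix : ∀ i, I i ≠ i) :
    IsPartitiveCrossing (G.involutionModules I) := by
  -- The bit from `A` also works on `A ∩ B`: its vertices are compared, within the module `B`, with
  -- some `t ∈ B \ A`.
  have hdiff : ∀ A ∈ G.involutionModules I, ∀ B ∈ G.involutionModules I, Crossing A B →
      ∀ s ∈ A \ B, ∀ v ∈ A \ B, ∃ b, ∀ x ∉ A \ B, G.E v x = twist I b (G.E s x) := by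
    intro A hA B hB hc s hs v hv
    rw [mem_involutionModules_iff G hK hI] at hA hB
    obtain ⟨t, htB, htA⟩ := hc.1.2.2
    obtain ⟨b, hb⟩ := hA s hs.1 v hv.1
    refine ⟨b, fun x hx => ?_⟩
    by_cases hxA : x ∈ A
    · have hxB : x ∈ B := by
        by_contra h
        exact hx ⟨hxA, h⟩
      obtain ⟨d, hd⟩ := hB t htB x hxB
      rw [G.symm v x, hd v hv.2, G.symm t v, hb t htA, G.symm s x, hd s hs.2, G.symm t s,
        twist_twist hI, twist_twist hI, Bool.xor_comm]
    · exact hb x hxA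
  refine ⟨fun s hs => hs.elim, fun s _ v _ => Or.inr fun i => ?_, ?_, ?_, ?_, ?_⟩
  · ext x
    simp [N]
  · intro A hA B hB hc
    rw [mem_involutionModules_iff G hK hI] at *
    obtain ⟨w, hwA, hwB⟩ := hc.1.1
    have key : ∀ s ∈ A ∪ B, ∃ b, ∀ x ∉ A ∪ B, G.E s x = twist I b (G.E w x) := by
      rintro s (hs | hs)
      · obtain ⟨b, hb⟩ := hA w hwA s hs
        exact ⟨b, fun x hx => hb x fun h => hx (Or.inl h)⟩
      · obtain ⟨b, hb⟩ := hB w hwB s hs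
        exact ⟨b, fun x hx => hb x fun h => hx (Or.inr h)⟩
    intro s hs v hv
    obtain ⟨b, hb⟩ := key s hs
    obtain ⟨c, hc⟩ := key v hv
    refine ⟨c ^^ b, fun x hx => ?_⟩
    rw [← twist_twist hI, hb x hx, twist_self hI, hc x hx]
  · intro A hA B hB hc
    rw [mem_involutionModules_iff G hK hI] at *
    obtain ⟨y, hy⟩ := Set.nonempty_compl.2 hc.2
    have hyA : y ∉ A := fun h => hy (Or.inl h)
    have hyB : y ∉ B := fun h => hy (Or.inr h)
    intro s hs v hv
    obtain ⟨b, hb⟩ := hA s hs.1 v hv.1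
    obtain ⟨c, hc⟩ := hB s hs.2 v hv.2
    -- Both bits describe the colours towards `y`, which lies outside `A ∪ B`.
    have hbc : b = c := by
      refine twist_injective hfix (hK s y fun e => hyA (e ▸ hs.1)) ?_
      rw [← hb y hyA, hc y hyB]
    subst hbc
    refine ⟨b, fun x hx => ?_⟩
    by_cases hxA : x ∈ A
    · exact hc x fun hxB => hx ⟨hxA, hxB⟩
    · exact hb x hxA
  · intro A hA B hB hc
    rw [mem_involutionModules_iff G hK hI]
    exact hdiff A hA B hB hc
  · intro A hA B hB hc
    have h1 := hdiff A hA B hB hc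
    have h2 := hdiff B hB A hA hc.symm
    rw [mem_involutionModules_iff G hK hI] at *
    obtain ⟨w, hwA, hwB⟩ := hc.1.1
    obtain ⟨y, hy⟩ := Set.nonempty_compl.2 hc.2
    have mixed : ∀ s ∈ A \ B, ∀ v ∈ B \ A, ∃ b, ∀ x ∉ symmDiff A B,
        G.E v x = twist I b (G.E s x) := by
      intro s hs v hv
      -- Passing from `s` to `v` through `z` composes the bits of `A` and `B`. The same composite
      -- relates the colours at `z` itself, since `v ∉ A` and `s ∉ B`.
      have out : ∀ z ∈ A, z ∈ B → ∃ b, (∀ x ∉ A ∪ B, G.E v x = twist I b (G.E s x)) ∧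
          G.E v z = twist I b (G.E s z) := by
        intro z hzA hzB
        obtain ⟨b, hb⟩ := hA s hs.1 z hzA
        obtain ⟨c, hc⟩ := hB z hzB v hv.1
        refine ⟨c ^^ b, fun x hx => ?_, ?_⟩
        · rw [← twist_twist hI, ← hb x fun h => hx (Or.inl h), hc x fun h => hx (Or.inr h)]
        · have e1 := hb v hv.2
          have e2 := hc s hs.2
          rw [G.symm v z, e1, G.symm s z, ← twist_self hI c (G.E z s), ← e2, twist_twist hI,
            Bool.xor_comm c b, Bool.xor_assoc, Bool.xor_self, Bool.xor_false, G.symm s v]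
      obtain ⟨b, hb, -⟩ := out w hwA hwB
      refine ⟨b, fun x hx => ?_⟩
      by_cases hxA : x ∈ A
      · have hxB : x ∈ B := by
          by_contra h
          exact hx (Or.inl ⟨hxA, h⟩)
        obtain ⟨c, hc, hcx⟩ := out x hxA hxB
        -- The bits obtained through `w` and through `x` agree because both act at `y`.
        have hbc : b = c := by
          refine twist_injective hfix (hK s y fun e => hy (e ▸ Or.inl hs.1)) ?_
          rw [← hb y hy, hc y hy]
        rwa [hbc]
      · refine hb x fun h => h.elim hxA fun hxB => hx (Or.inr ⟨hxB, hxA⟩)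
    rintro s (hs | hs) v (hv | hv)
    · obtain ⟨b, hb⟩ := h1 s hs v hv
      exact ⟨b, fun x hx => hb x fun h => hx (Or.inl h)⟩
    · exact mixed s hs v hv
    · obtain ⟨b, hb⟩ := mixed v hv s hs
      exact ⟨b, fun x hx => by rw [hb x hx, twist_self hI]⟩
    · obtain ⟨b, hb⟩ := h2 s hs v hv
      exact ⟨b, fun x hx => hb x fun h => hx (Or.inr h)⟩

end TwoStructure

/-! ### Edge sides and reconstruction of a tree from them -/

namespace DirectedTree

variable {X : Type u} (T : DirectedTree X)

open SimpleGraph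

theorem mem_side {x : X} {w v : T.V} : x ∈ T.side w v ↔ T.graph.Below v (T.leaf x) w :=
  mem_support_of_isTree T.isTree

theorem side_compl {w v : T.V} (h : T.graph.Adj w v) : (T.side w v)ᶜ = T.side v w := by
  ext x
  rw [Set.mem_compl_iff, mem_side, mem_side, h.below_iff_not T.isTree]

/-- The leaves below `u`, if the tree is rooted at `r`. -/
def cluster (r u : T.V) : Set X := {x | T.graph.Below r (T.leaf x) u}

/-- `A` is one of the two sets of leaves obtained by removing an edge. -/
def IsEdgeSide (A : Set X) : Prop := ∃ w v, T.graph.Adj w v ∧ A = T.side w v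

variable {T}

theorem IsEdgeSide.compl {A : Set X} (h : T.IsEdgeSide A) : T.IsEdgeSide Aᶜ := by
  obtain ⟨w, v, hwv, rfl⟩ := h
  exact ⟨v, w, hwv.symm, T.side_compl hwv⟩

theorem isEdgeSide_compl {A : Set X} : T.IsEdgeSide Aᶜ ↔ T.IsEdgeSide A :=
  ⟨fun h => by simpa using h.compl, IsEdgeSide.compl⟩

theorem side_eq_cluster {r u v : T.V} (h : T.graph.Adj u v) (hb : T.graph.Below r u v) :
    T.side u v = T.cluster r u := by
  ext x
  rw [mem_side, below_parent_iff T.isTree h hb]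
  rfl

/-- Of at least three neighbours, at most one is the parent and at most one is `c`. -/
theorem exists_children_of_isInternal {m : T.V} (hm : T.IsInternal m) (r c : T.V) :
    ∃ c', c' ≠ c ∧ T.graph.Adj c' m ∧ T.graph.Below r c' m := by
  have h3 := T.internal_degree m hm
  have hone : ({v ∈ T.graph.neighborSet m | T.graph.Below r m v} ∪ {c}).ncard ≤ 2 := by
    refine (Set.ncard_union_le _ _).trans (Nat.add_le_add ?_ (Set.ncard_singleton c).le)
    have := T.finite
    rw [Set.ncard_le_one]
    rintro a ⟨ha, ha'⟩ b ⟨hb, hb'⟩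
    exact ha'.eq_of_adj T.isTree.connected ha hb hb'
  have := T.finite
  obtain ⟨c', hc', hn⟩ := Set.exists_mem_notMem_of_ncard_lt_ncard (lt_of_le_of_lt hone h3)
  simp only [Set.mem_union, Set.mem_ofPred_eq, Set.mem_singleton_iff, not_or, not_and] at hn
  have hadj : T.graph.Adj m c' := hc'
  exact ⟨c', hn.2, hadj.symm, (hadj.below_or T.isTree r).resolve_left (hn.1 hc')⟩

/-- A deepest node below `u` has no child, so it is a leaf. -/
theorem cluster_nonempty (r u : T.V) : (T.cluster r u).Nonempty := by
  have := T.finite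
  obtain ⟨m, hm, hmax⟩ := Set.exists_max_image {m | T.graph.Below r m u}
    (fun m => T.graph.dist m r) (Set.toFinite _) ⟨u, Below.refl _ _ _⟩
  by_cases hi : T.IsInternal m
  · obtain ⟨c, -, hc, hb⟩ := exists_children_of_isInternal hi r m
    have h1 := hmax c (hb.trans hm)
    have h2 := hb.dist_lt T.isTree.connected hc.ne
    omega
  · obtain ⟨x, hx⟩ := not_not.1 hi
    exact ⟨x, show T.graph.Below r (T.leaf x) u from hx ▸ hm⟩

theorem side_nonempty (w v : T.V) : (T.side w v).Nonempty := by
  obtain ⟨x, hx⟩ := cluster_nonempty v w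
  exact ⟨x, T.mem_side.2 hx⟩

theorem exists_mem_side {x : X} {v : T.V} (h : T.leaf x ≠ v) :
    ∃ w, T.graph.Adj w v ∧ x ∈ T.side w v := by
  obtain ⟨w, h1, -, h2⟩ := (Below.root T.graph v (T.leaf x)).exists_child T.isTree h
  exact ⟨w, h1, T.mem_side.2 h2⟩

theorem eq_of_mem_side {x : X} {v w w' : T.V} (h : T.graph.Adj w v) (h' : T.graph.Adj w' v)
    (hx : x ∈ T.side w v) (hx' : x ∈ T.side w' v) : w = w' :=
  Below.eq_child T.isTree.connected h h' (Below.root _ _ _) (Below.root _ _ _)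
    (T.mem_side.1 hx) (T.mem_side.1 hx')

theorem side_subset_compl {v w w' : T.V} (h : T.graph.Adj w v) (h' : T.graph.Adj w' v)
    (hne : w ≠ w') : T.side w v ⊆ (T.side w' v)ᶜ :=
  fun _ hx hx' => hne (eq_of_mem_side h h' hx hx')

/-- One side of each edge is contained in a branch at `v`. -/
theorem IsEdgeSide.subset_branch {A : Set X} (h : T.IsEdgeSide A) (v : T.V) :
    ∃ w, T.graph.Adj w v ∧ (A ⊆ T.side w v ∨ Aᶜ ⊆ T.side w v) := by
  obtain ⟨a, b, hab, rfl⟩ := h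
  wlog hb : T.graph.Below v a b generalizing a b
  · obtain ⟨w, hw, h⟩ := this b a hab.symm ((hab.below_or T.isTree v).resolve_left hb)
    rw [← T.side_compl hab, compl_compl] at h
    exact ⟨w, hw, h.symm⟩
  have hav : a ≠ v := by
    rintro rfl
    exact hab.ne hb.eq_root.symm
  obtain ⟨w, h1, -, h2⟩ := (Below.root T.graph v a).exists_child T.isTree hav
  refine ⟨w, h1, Or.inl ?_⟩
  rw [side_eq_cluster hab hb]
  intro x hx
  exact T.mem_side.2 (Below.trans hx h2)

/-- A union of branches at a node does not cross the sides of edges. -/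
theorem IsEdgeSide.not_crossing {A D : Set X} (hD : T.IsEdgeSide D) (v : T.V)
    (hA : ∀ w, T.graph.Adj w v → T.side w v ⊆ A ∨ T.side w v ⊆ Aᶜ) : ¬ Crossing A D := by
  intro hc
  obtain ⟨w, hw, h⟩ := hD.subset_branch v
  obtain ⟨⟨x, hx, hxD⟩, ⟨y, hy, hyD⟩, ⟨z, hz, hzD⟩, ⟨t, ht, htD⟩⟩ := crossing_iff.1 hc
  rcases h with h | h <;> rcases hA w hw with h' | h'
  · exact hz (h' (h hzD))
  · exact h' (h hxD) hx
  · exact ht (h' (h htD))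
  · exact h' (h hyD) hy

theorem isEdgeSide_iff_cluster (r : T.V) {A : Set X} :
    T.IsEdgeSide A ↔ ∃ u ≠ r, A = T.cluster r u ∨ A = (T.cluster r u)ᶜ := by
  constructor
  · rintro ⟨w, v, hwv, rfl⟩
    rcases hwv.below_or T.isTree r with hb | hb
    · refine ⟨w, ?_, Or.inl (side_eq_cluster hwv hb)⟩
      rintro rfl
      exact hwv.ne hb.eq_root.symm
    · refine ⟨v, ?_, Or.inr ?_⟩
      · rintro rfl
        exact hwv.ne hb.eq_root
      · rw [← side_eq_cluster hwv.symm hb, T.side_compl hwv.symm]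
  · rintro ⟨u, hu, h⟩
    obtain ⟨v, huv, hb⟩ := T.isTree.exists_parent hu
    rw [← side_eq_cluster huv hb] at h
    rcases h with rfl | rfl
    · exact ⟨u, v, huv, rfl⟩
    · exact ⟨v, u, huv.symm, T.side_compl huv⟩

theorem cluster_root (r : T.V) : T.cluster r r = Set.univ :=
  Set.eq_univ_of_forall fun _ => Below.root _ _ _

theorem eq_of_adj_leaf {x : X} {a b : T.V} (ha : T.graph.Adj (T.leaf x) a)
    (hb : T.graph.Adj (T.leaf x) b) : a = b := by
  have := T.finite
  exact (Set.ncard_le_one (Set.toFinite _)).1 (T.leaf_degree x) a ha b hb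

theorem below_leaf {r : T.V} {u : T.V} {x : X} (hr : T.leaf x ≠ r)
    (h : T.graph.Below r u (T.leaf x)) : u = T.leaf x := by
  by_contra hne
  obtain ⟨c, hc, hb, -⟩ := h.exists_child T.isTree hne
  obtain ⟨p, hp, hb'⟩ := T.isTree.exists_parent hr
  rw [eq_of_adj_leaf hc.symm hp] at hb
  exact hp.ne (hb'.antisymm T.isTree.connected hb)

theorem cluster_leaf {r : T.V} {x : X} (hr : T.leaf x ≠ r) : T.cluster r (T.leaf x) = {x} := by
  ext y
  constructor
  · exact fun h => T.leaf_injective (below_leaf hr h)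
  · rintro rfl
    exact Below.refl _ _ _

theorem notMem_cluster {r : X} {u : T.V} (hu : u ≠ T.leaf r) : r ∉ T.cluster (T.leaf r) u :=
  fun h => hu (Below.eq_root h)

/-- If `v` were strictly below an internal node `u`, then `u` would have a child away from `v`,
whose leaves lie in the cluster of `u` but not in that of `v`. This is where nodes with only two
neighbours would do harm. -/
theorem cluster_subset_iff {r : X} {u v : T.V} :
    T.cluster (T.leaf r) u ⊆ T.cluster (T.leaf r) v ↔ T.graph.Below (T.leaf r) u v := by
  refine ⟨fun hs => ?_, fun h x hx => Below.trans hx h⟩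
  by_contra hn
  obtain ⟨x, hx⟩ := cluster_nonempty (T.leaf r) u
  have hvu := (Below.total T.isTree.connected hx (hs hx)).resolve_left hn
  have hne : v ≠ u := by
    rintro rfl
    exact hn hvu
  by_cases hi : T.IsInternal u
  · obtain ⟨c, hc, hcu, hvc⟩ := hvu.exists_child T.isTree hne
    obtain ⟨c', hcc', hc', hcu'⟩ := exists_children_of_isInternal hi (T.leaf r) c
    obtain ⟨y, hy⟩ := cluster_nonempty (T.leaf r) c'
    have hy' := hs (Below.trans hy hcu')
    exact hcc' (Below.eq_child T.isTree.connected hc' hc hcu' hcu hy (Below.trans hy' hvc))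
  · obtain ⟨y, rfl⟩ := not_not.1 hi
    by_cases hy : T.leaf y = T.leaf r
    · rw [hy] at hs hne
      exact notMem_cluster hne (hs (Below.refl _ _ _))
    · exact hne (below_leaf hy hvu)

theorem cluster_injective (r : X) : Function.Injective (T.cluster (T.leaf r)) := fun _ _ h =>
  Below.antisymm T.isTree.connected (cluster_subset_iff.1 h.le) (cluster_subset_iff.1 h.ge)

theorem exists_cluster_eq_iff {r : X} {A : Set X} :
    (∃ u, T.cluster (T.leaf r) u = A) ↔ A = Set.univ ∨ T.IsEdgeSide A ∧ r ∉ A := by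
  rw [isEdgeSide_iff_cluster (T.leaf r)]
  constructor
  · rintro ⟨u, rfl⟩
    by_cases hu : u = T.leaf r
    · exact Or.inl (hu ▸ cluster_root _)
    · exact Or.inr ⟨⟨u, hu, Or.inl rfl⟩, notMem_cluster hu⟩
  · rintro (rfl | ⟨⟨u, hu, rfl | rfl⟩, hr⟩)
    · exact ⟨_, cluster_root _⟩
    · exact ⟨u, rfl⟩
    · exact absurd (notMem_cluster hu) hr

/-- Adjacency is the covering relation of the clusters, so any bijection of nodes that respects
clusters is a graph isomorphism. -/
theorem adj_iff {r : X} {u v : T.V} : T.graph.Adj u v ↔ u ≠ v ∧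
    ((T.cluster (T.leaf r) u ⊆ T.cluster (T.leaf r) v ∧ ∀ z,
      T.cluster (T.leaf r) u ⊆ T.cluster (T.leaf r) z →
      T.cluster (T.leaf r) z ⊆ T.cluster (T.leaf r) v → z = u ∨ z = v) ∨
    (T.cluster (T.leaf r) v ⊆ T.cluster (T.leaf r) u ∧ ∀ z,
      T.cluster (T.leaf r) v ⊆ T.cluster (T.leaf r) z →
      T.cluster (T.leaf r) z ⊆ T.cluster (T.leaf r) u → z = v ∨ z = u)) := by
  simp only [cluster_subset_iff]
  have key : ∀ a b : T.V, T.graph.Adj a b → T.graph.Below (T.leaf r) a b → ∀ z,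
      T.graph.Below (T.leaf r) a z → T.graph.Below (T.leaf r) z b → z = a ∨ z = b := by
    intro a b hab h z haz hzb
    by_contra! hc
    exact hc.2 (hzb.antisymm T.isTree.connected (haz.of_adj hab hc.1.symm))
  have key' : ∀ a b : T.V, a ≠ b → T.graph.Below (T.leaf r) a b → (∀ z,
      T.graph.Below (T.leaf r) a z → T.graph.Below (T.leaf r) z b → z = a ∨ z = b) →
      T.graph.Adj a b := by
    intro a b hab h hz
    obtain ⟨c, hc, hcb, hac⟩ := h.exists_child T.isTree hab
    rcases hz c hac hcb with rfl | rfl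
    · exact hc
    · exact absurd rfl hc.ne
  constructor
  · intro h
    refine ⟨h.ne, ?_⟩
    rcases h.below_or T.isTree (T.leaf r) with hb | hb
    · exact Or.inl ⟨hb, key u v h hb⟩
    · exact Or.inr ⟨hb, key v u h.symm hb⟩
  · rintro ⟨hne, ⟨h1, h2⟩ | ⟨h1, h2⟩⟩
    · exact key' u v hne h1 h2
    · exact (key' v u hne.symm h1 h2).symm

/-- A tree is determined by the sides of its edges. -/
theorem exists_iso_of_isEdgeSide_iff [Nonempty X] {T' : DirectedTree X}
    (h : ∀ A, T.IsEdgeSide A ↔ T'.IsEdgeSide A) :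
    ∃ φ : T.graph ≃g T'.graph, ∀ x, φ (T.leaf x) = T'.leaf x := by
  obtain ⟨r⟩ := ‹Nonempty X›
  have h1 : ∀ u, ∃ u', T'.cluster (T'.leaf r) u' = T.cluster (T.leaf r) u := fun u => by
    rw [exists_cluster_eq_iff, ← h, ← exists_cluster_eq_iff]
    exact ⟨u, rfl⟩
  have h2 : ∀ u', ∃ u, T.cluster (T.leaf r) u = T'.cluster (T'.leaf r) u' := fun u => by
    rw [exists_cluster_eq_iff, h, ← exists_cluster_eq_iff]
    exact ⟨u, rfl⟩
  choose f hf using h1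
  choose g hg using h2
  let e : T.V ≃ T'.V :=
    { toFun := f
      invFun := g
      left_inv := fun u => cluster_injective r (by rw [hg, hf])
      right_inv := fun u => cluster_injective r (by rw [hf, hg]) }
  have he : ∀ u, T'.cluster (T'.leaf r) (e u) = T.cluster (T.leaf r) u := hf
  refine ⟨⟨e, ?_⟩, fun x => cluster_injective r ?_⟩
  · intro a b
    rw [adj_iff (r := r), adj_iff (r := r)]
    simp only [he, e.surjective.forall, e.injective.eq_iff, ne_eq]
  · change T'.cluster (T'.leaf r) (e (T.leaf x)) = _
    rw [he]
    by_cases hx : x = r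
    · subst hx
      rw [cluster_root, cluster_root]
    · rw [cluster_leaf (T.leaf_injective.ne hx), cluster_leaf (T'.leaf_injective.ne hx)]

theorem side_iso {T' : DirectedTree X} (φ : T.graph ≃g T'.graph)
    (hφ : ∀ x, φ (T.leaf x) = T'.leaf x) (w v : T.V) : T'.side (φ w) (φ v) = T.side w v := by
  ext x
  rw [mem_side, mem_side, ← hφ, Below.iso]

end DirectedTree

/-- The bipartition of `X` into `A` and its complement is proper, one of its sides belongs to `F`,
and it is not crossed by any member of `F`. -/
structure IsStrongSplit {X : Type u} (F : Set (Set X)) (A : Set X) : Prop where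
  nonempty : A.Nonempty
  compl_nonempty : Aᶜ.Nonempty
  mem_or : A ∈ F ∨ Aᶜ ∈ F
  not_crossing : ∀ B ∈ F, ¬ Crossing B A

theorem IsStrongSplit.compl {X : Type u} {F : Set (Set X)} {A : Set X} (h : IsStrongSplit F A) :
    IsStrongSplit F Aᶜ where
  nonempty := h.compl_nonempty
  compl_nonempty := by simpa using h.nonempty
  mem_or := by simpa using h.mem_or.symm
  not_crossing := fun B hB hc => h.not_crossing B hB (crossing_compl_right.1 hc)

/-! ### Edges of a representation are the strong splits; uniqueness -/

namespace DirectedTree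

open SimpleGraph

variable {X : Type u} {F : Set (Set X)} {T : DirectedTree X}

theorem side_subset_biUnion {v : T.V} {I : Set T.V} (hI : ∀ i ∈ I, T.graph.Adj i v) (w : T.V)
    (hw : T.graph.Adj w v) :
    T.side w v ⊆ ⋃ i ∈ I, T.side i v ∨ T.side w v ⊆ (⋃ i ∈ I, T.side i v)ᶜ := by
  by_cases h : w ∈ I
  · exact Or.inl (Set.subset_biUnion_of_mem (u := fun i => T.side i v) h)
  · refine Or.inr fun x hx hx' => ?_
    obtain ⟨i, hi, hxi⟩ := Set.mem_iUnion₂.1 hx'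
    exact h (eq_of_mem_side hw (hI i hi) hx hxi ▸ hi)

theorem adj_of_mem_children {v w : T.V} (h : w ∈ T.children v) : T.graph.Adj w v :=
  T.arc_adj _ _ h.1

theorem Represents.isStrongSplit (h : T.Represents F) {A : Set X} (hA : T.IsEdgeSide A) :
    IsStrongSplit F A := by
  obtain ⟨w, v, hwv, rfl⟩ := id hA
  refine ⟨side_nonempty _ _, T.side_compl hwv ▸ side_nonempty _ _, ?_, ?_⟩
  · rw [T.side_compl hwv, ← h.arc_iff _ _ hwv, ← h.arc_iff _ _ hwv.symm]
    exact T.adj_arc _ _ hwv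
  · intro B hB
    rcases (h.mem_iff B).1 hB with rfl | rfl | ⟨a, b, hab, rfl⟩ | ⟨a, -, -, I, hI, -, -, rfl⟩
    · intro hc
      obtain ⟨⟨x, hx, -⟩, -⟩ := crossing_iff.1 hc
      exact hx
    · intro hc
      obtain ⟨-, -, ⟨x, hx, -⟩, -⟩ := crossing_iff.1 hc
      exact hx (Set.mem_univ x)
    · refine hA.not_crossing b fun c hc => ?_
      rcases eq_or_ne c a with rfl | hca
      · exact Or.inl subset_rfl
      · exact Or.inr (side_subset_compl hc (T.arc_adj _ _ hab) hca)
    · exact hA.not_crossing a (side_subset_biUnion fun i hi => adj_of_mem_children (hI hi))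

/-- The critical case is a union of children `I` at a complete node, with a child `j` left out:
unless `j` is the only neighbour left out, the union of `j` with one element of `I` is a member that
crosses `A`. -/
theorem Represents.isEdgeSide_of_mem (h : T.Represents F) {A : Set X} (hA : IsStrongSplit F A)
    (hAF : A ∈ F) : T.IsEdgeSide A := by
  rcases (h.mem_iff A).1 hAF with rfl | rfl | ⟨a, b, hab, rfl⟩ | ⟨v, hv, hl, I, hI, h1, h2, e⟩
  · exact absurd hA.nonempty Set.not_nonempty_empty
  · exact absurd hA.compl_nonempty (by simp)
  · exact ⟨a, b, T.arc_adj _ _ hab, rfl⟩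
  · have := T.finite
    have hadj : ∀ i ∈ I, T.graph.Adj i v := fun i hi => adj_of_mem_children (hI hi)
    obtain ⟨j, hj, hjI⟩ := Set.exists_mem_notMem_of_ncard_lt_ncard h2
    have hjv := adj_of_mem_children hj
    have hjA := (side_subset_biUnion hadj j hjv).resolve_left fun hs => by
      obtain ⟨x, hx⟩ := side_nonempty j v
      obtain ⟨i, hi, hxi⟩ := Set.mem_iUnion₂.1 (hs hx)
      exact hjI (eq_of_mem_side hjv (hadj i hi) hx hxi ▸ hi)
    rw [← e] at hjA
    have hsub : ∀ i ∈ I, T.side i v ⊆ A := fun i hi =>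
      e ▸ Set.subset_biUnion_of_mem (u := fun i => T.side i v) hi
    by_cases hk : ∃ k, T.graph.Adj k v ∧ k ∉ I ∧ k ≠ j
    · obtain ⟨k, hkv, hkI, hkj⟩ := hk
      obtain ⟨i, i', hi, hi', hii'⟩ := (Set.one_lt_ncard_iff (Set.toFinite I)).1 h1
      have hij : i ≠ j := fun e => hjI (e ▸ hi)
      have hc : T.IsChildUnion v (T.side i v ∪ T.side j v) := by
        refine ⟨{i, j}, ?_, ?_, ?_, by simp⟩
        · rintro x (rfl | rfl)
          · exact hI hi
          · exact hj
        · rw [Set.ncard_pair hij]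
          exact one_lt_two
        · rw [Set.ncard_pair hij]
          omega
      have hmem : T.side i v ∪ T.side j v ∈ F :=
        (h.mem_iff _).2 (Or.inr (Or.inr (Or.inr ⟨v, hv, hl, hc⟩)))
      refine absurd (crossing_iff.2 ⟨?_, ?_, ?_, ?_⟩) (hA.not_crossing _ hmem)
      · obtain ⟨x, hx⟩ := side_nonempty i v
        exact ⟨x, Or.inl hx, hsub i hi hx⟩
      · obtain ⟨x, hx⟩ := side_nonempty j v
        exact ⟨x, Or.inr hx, hjA hx⟩
      · obtain ⟨x, hx⟩ := side_nonempty i' v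
        refine ⟨x, ?_, hsub i' hi' hx⟩
        rintro (h' | h')
        · exact hii' (eq_of_mem_side (hadj i hi) (hadj i' hi') h' hx)
        · exact hjI (eq_of_mem_side hjv (hadj i' hi') h' hx ▸ hi')
      · obtain ⟨x, hx⟩ := side_nonempty k v
        refine ⟨x, ?_, fun hxA => ?_⟩
        · rintro (h' | h')
          · exact hkI (eq_of_mem_side hkv (hadj i hi) hx h' ▸ hi)
          · exact hkj (eq_of_mem_side hkv hjv hx h')
        · rw [e] at hxA
          obtain ⟨l, hl, hxl⟩ := Set.mem_iUnion₂.1 hxA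
          exact hkI (eq_of_mem_side hkv (hadj l hl) hx hxl ▸ hl)
    -- Now `j` is the only branch outside `I`, so the complement of `A` is the side of `j`.
    · rw [← isEdgeSide_compl]
      refine ⟨j, v, hjv, Set.Subset.antisymm (fun x hx => ?_) hjA⟩
      obtain ⟨w, hw, hxw⟩ := exists_mem_side (x := x) (v := v) fun e => hv ⟨x, e⟩
      have hwI : w ∉ I := fun hwI => hx (hsub w hwI hxw)
      by_contra hxj
      refine hk ⟨w, hw, hwI, ?_⟩
      rintro rfl
      exact hxj hxw

theorem Represents.isEdgeSide_iff (h : T.Represents F) {A : Set X} :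
    T.IsEdgeSide A ↔ IsStrongSplit F A := by
  refine ⟨h.isStrongSplit, fun hA => ?_⟩
  rcases hA.mem_or with hm | hm
  · exact h.isEdgeSide_of_mem hA hm
  · exact isEdgeSide_compl.1 (h.isEdgeSide_of_mem hA.compl hm)

theorem Represents.arc_iff_adj_and (h : T.Represents F) (v w : T.V) :
    T.Arc v w ↔ T.graph.Adj v w ∧ T.side v w ∈ F :=
  ⟨fun ha => ⟨T.arc_adj _ _ ha, (h.arc_iff _ _ (T.arc_adj _ _ ha)).1 ha⟩,
    fun ha => (h.arc_iff _ _ ha.1).2 ha.2⟩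

theorem IsChildUnion.iso {T' : DirectedTree X} (φ : T.graph ≃g T'.graph)
    (hφ : ∀ x, φ (T.leaf x) = T'.leaf x) (harc : ∀ v w, T.Arc v w ↔ T'.Arc (φ v) (φ w))
    {v : T.V} {A : Set X} (h : T.IsChildUnion v A) : T'.IsChildUnion (φ v) A := by
  have hch : ∀ w, φ w ∈ T'.children (φ v) ↔ w ∈ T.children v := by
    intro w
    simp only [children, Set.mem_ofPred_eq, harc, φ.surjective.forall, φ.injective.eq_iff]
  have himg : T'.children (φ v) = φ '' T.children v := by
    ext w
    obtain ⟨w, rfl⟩ := φ.surjective w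
    rw [hch, φ.injective.mem_set_image]
  obtain ⟨I, hI, h1, h2, rfl⟩ := h
  refine ⟨φ '' I, himg ▸ Set.image_mono hI, ?_, ?_, ?_⟩
  · rwa [Set.ncard_image_of_injective _ φ.injective]
  · rwa [himg, Set.ncard_image_of_injective _ φ.injective,
      Set.ncard_image_of_injective _ φ.injective]
  · simp only [Set.biUnion_image, side_iso φ hφ]

/-- Uniqueness of the tree-representation. -/
theorem Represents.isIsomorphic [Nonempty X] {T' : DirectedTree X} (h : T.Represents F)
    (h' : T'.Represents F) : T.IsIsomorphic T' := by
  obtain ⟨φ, hφ⟩ := exists_iso_of_isEdgeSide_iff (T := T) (T' := T')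
    fun A => h.isEdgeSide_iff.trans h'.isEdgeSide_iff.symm
  have harc : ∀ v w, T.Arc v w ↔ T'.Arc (φ v) (φ w) := fun v w => by
    rw [h.arc_iff_adj_and, h'.arc_iff_adj_and, side_iso φ hφ, φ.map_adj_iff]
  refine ⟨φ, hφ, harc, fun v hv => ?_⟩
  have hφ' : ∀ x, φ.symm (T'.leaf x) = T.leaf x := fun x => by rw [← hφ, φ.symm_apply_apply]
  have harc' : ∀ v w, T'.Arc v w ↔ T.Arc (φ.symm v) (φ.symm w) := fun v w => by
    rw [harc, φ.apply_symm_apply, φ.apply_symm_apply]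
  have hv' : T'.IsInternal (φ v) := fun ⟨x, hx⟩ => hv ⟨x, φ.injective (by rw [hφ, hx])⟩
  have key : T.label v = NodeLabel.complete ↔ T'.label (φ v) = NodeLabel.complete := by
    rw [h.complete_iff v hv, h'.complete_iff _ hv']
    refine forall_congr' fun A => imp_congr_left ⟨IsChildUnion.iso φ hφ harc, fun hA => ?_⟩
    have := IsChildUnion.iso φ.symm hφ' harc' hA
    rwa [φ.symm_apply_apply] at this
  cases h1 : T.label v <;> cases h2 : T'.label (φ v) <;> simp_all

/-! ### Existence -/

/-- A set that does not cross any side of an edge, and is not such a side, is a union of branches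
at an internal node. -/
theorem exists_isInternal_branches {A : Set X} (hA : A.Nonempty) (hAc : Aᶜ.Nonempty)
    (hne : ¬ T.IsEdgeSide A) (hc : ∀ D, T.IsEdgeSide D → ¬ Crossing A D) :
    ∃ v, T.IsInternal v ∧ ∀ w, T.graph.Adj w v → T.side w v ⊆ A ∨ T.side w v ⊆ Aᶜ := by
  obtain ⟨r, hr⟩ := hAc
  have := T.finite
  -- Root at a leaf outside `A` and take a deepest node whose cluster contains `A`. No child branch
  -- contains `A`, and `r` lies outside both, so not crossing forces each child branch into `A` or
  -- its complement.
  obtain ⟨u, hu, hmax⟩ := Set.exists_max_image {u | A ⊆ T.cluster (T.leaf r) u}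
    (fun u => T.graph.dist u (T.leaf r)) (Set.toFinite _)
    ⟨T.leaf r, by simp [cluster_root]⟩
  have hchild : ∀ w, T.graph.Adj w u → T.graph.Below (T.leaf r) w u →
      ¬ A ⊆ T.cluster (T.leaf r) w := by
    intro w hw hb hs
    have h1 := hmax w hs
    have h2 := hb.dist_lt T.isTree.connected hw.ne
    omega
  refine ⟨u, ?_, fun w hw => ?_⟩
  · rintro ⟨y, rfl⟩
    by_cases hy : T.leaf y = T.leaf r
    · obtain ⟨x, hx⟩ := hA
      have hleaf : ∀ x ∈ A, T.leaf x ≠ T.leaf r := fun x hx e => hr (T.leaf_injective e ▸ hx)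
      obtain ⟨c, hc, hcb, -⟩ := (Below.root T.graph (T.leaf r) (T.leaf x)).exists_child
        T.isTree (hleaf x hx)
      rw [hy] at hchild
      refine hchild c hc hcb fun z hz => ?_
      obtain ⟨c', hc', -, hzc'⟩ := (Below.root T.graph (T.leaf r) (T.leaf z)).exists_child
        T.isTree (hleaf z hz)
      rw [eq_of_adj_leaf hc.symm hc'.symm]
      exact hzc'
    · refine hne ((isEdgeSide_iff_cluster (T.leaf r)).2 ⟨T.leaf y, hy, Or.inl ?_⟩)
      rw [Set.mem_ofPred_eq] at hu
      rw [cluster_leaf hy] at hu ⊢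
      exact hu.antisymm (by
        obtain ⟨x, hx⟩ := hA
        rw [Set.singleton_subset_iff]
        have : x = y := hu hx
        exact this ▸ hx)
  · rcases hw.below_or T.isTree (T.leaf r) with hb | hb
    · have hcw := hc _ ⟨w, u, hw, rfl⟩
      have hw' := hchild w hw hb
      rw [← side_eq_cluster hw hb] at hw'
      obtain ⟨a, haA, ha⟩ := Set.not_subset.1 hw'
      have hrw : r ∉ T.side w u := by
        rw [side_eq_cluster hw hb]
        refine notMem_cluster ?_
        rintro rfl
        exact hw.ne hb.eq_root.symm
      by_contra! hcon
      obtain ⟨⟨b, hb, hbA⟩, ⟨c, hc, hcA⟩⟩ :=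
        And.intro (Set.not_subset.1 hcon.1) (Set.not_subset.1 hcon.2)
      exact hcw (crossing_iff.2 ⟨⟨c, not_not.1 hcA, hc⟩, ⟨a, haA, ha⟩, ⟨b, hbA, hb⟩, ⟨r, hr, hrw⟩⟩)
    · right
      rw [← T.side_compl hw.symm, side_eq_cluster hw.symm hb]
      exact Set.compl_subset_compl.2 hu

/-- An edge side or its complement fits into a single branch, which forces `J` or `Jᶜ` into a
singleton. -/
theorem IsEdgeSide.not_nontrivial_preimage {v : T.V} {f : X → {w // T.graph.Adj w v}}
    (hf : ∀ x i, f x = i ↔ x ∈ T.side i v) {J : Set {w // T.graph.Adj w v}}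
    (hJ : J.Nontrivial) (hJc : Jᶜ.Nontrivial) : ¬ T.IsEdgeSide (f ⁻¹' J) := by
  intro h
  obtain ⟨w, hw, hs⟩ := h.subset_branch v
  have key : ∀ K : Set {w // T.graph.Adj w v}, f ⁻¹' K ⊆ T.side w v → K ⊆ {⟨w, hw⟩} := by
    intro K hK i hi
    obtain ⟨x, hx⟩ := side_nonempty (i : T.V) v
    have hxi := (hf x i).2 hx
    have := hK (show f x ∈ K from hxi ▸ hi)
    rw [← hxi]
    exact (hf x ⟨w, hw⟩).2 this
  rcases hs with hs | hs
  · exact Set.not_nontrivial_singleton (hJ.mono (key J hs))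
  · exact Set.not_nontrivial_singleton (hJc.mono (key Jᶜ hs))

/-- The substantial point is that a member other than an edge side is a union of children at a
complete node; it is read off in the family `H` on the neighbours of that node. -/
theorem represents_of_isEdgeSide_iff (hF : IsPartitiveCrossing F)
    (hc : ∀ A D : Set X, A.Nonempty → A ⊆ D → D ∈ F → Aᶜ ∈ F → Dᶜ ∈ F)
    (hT : ∀ A, T.IsEdgeSide A ↔ IsStrongSplit F A)
    (harc : ∀ v w, T.Arc v w ↔ T.graph.Adj v w ∧ T.side v w ∈ F)
    (hlabel : ∀ v, T.label v = NodeLabel.complete ↔ ∀ A, T.IsChildUnion v A → A ∈ F) :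
    T.Represents F where
  arc_iff := fun v w h => by rw [harc, and_iff_right h]
  complete_iff := fun v _ => hlabel v
  mem_iff := fun A => by
    constructor
    swap
    · rintro (rfl | rfl | ⟨v, w, h, rfl⟩ | ⟨v, -, hl, h⟩)
      · exact hF.empty_mem
      · exact hF.univ_mem
      · exact ((harc _ _).1 h).2
      · exact (hlabel v).1 hl A h
    intro hA
    rcases A.eq_empty_or_nonempty with rfl | hAn
    · exact Or.inl rfl
    rcases Set.eq_empty_or_nonempty Aᶜ with hAc | hAc
    · exact Or.inr (Or.inl (Set.compl_empty_iff.1 hAc))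
    right; right
    by_cases hE : T.IsEdgeSide A
    · obtain ⟨w, v, hwv, rfl⟩ := hE
      exact Or.inl ⟨w, v, (harc _ _).2 ⟨hwv, hA⟩, rfl⟩
    right
    obtain ⟨v, hv, hbr⟩ := exists_isInternal_branches hAn hAc hE
      fun D hD => ((hT D).1 hD).not_crossing A hA
    have := T.finite
    have hex : ∀ x, ∃ i : {w // T.graph.Adj w v}, x ∈ T.side i v := fun x => by
      obtain ⟨w, hw, hx⟩ := exists_mem_side (x := x) (v := v) fun e => hv ⟨x, e⟩
      exact ⟨⟨w, hw⟩, hx⟩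
    choose f hf' using hex
    have hf : ∀ x i, f x = i ↔ x ∈ T.side i v := fun x i =>
      ⟨fun e => e ▸ hf' x, fun h => Subtype.ext (eq_of_mem_side (f x).2 i.2 (hf' x) h)⟩
    have hsurj : Function.Surjective f := fun i => by
      obtain ⟨x, hx⟩ := side_nonempty (i : T.V) v
      exact ⟨x, (hf x i).2 hx⟩
    have hpre : ∀ i : {w // T.graph.Adj w v}, f ⁻¹' {i} = T.side i v := fun i =>
      Set.ext fun x => hf x i
    have hpre' : ∀ i : {w // T.graph.Adj w v}, f ⁻¹' {i}ᶜ = T.side v i := fun i => by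
      rw [Set.preimage_compl, hpre, T.side_compl i.2]
    have hunion : ∀ B : Set X, (∀ w, T.graph.Adj w v → T.side w v ⊆ B ∨ T.side w v ⊆ Bᶜ) →
        ∃ J, B = f ⁻¹' J := by
      intro B hB
      refine ⟨{i | T.side i v ⊆ B}, Set.ext fun x => ⟨fun hx => ?_, fun hx => hx (hf' x)⟩⟩
      exact (hB (f x) (f x).2).resolve_right fun h => h (hf' x) hx
    set H : Set (Set {w // T.graph.Adj w v}) := {J | f ⁻¹' J ∈ F} with hH
    -- The preimage of `J` is no edge side, hence no strong split, so some member `B` crosses it.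
    -- Both `B` and its complement meet more than one branch, and `B` crosses no branch; so `B` is a
    -- union of branches and descends to `H`.
    have hcr : ∀ J ∈ H, J.Nontrivial → Jᶜ.Nontrivial → ∃ J' ∈ H, Crossing J J' := by
      intro J hJ hJn hJc
      have hns := mt (hT _).2 (IsEdgeSide.not_nontrivial_preimage hf hJn hJc)
      have : ∃ B ∈ F, Crossing B (f ⁻¹' J) := by
        by_contra! hcon
        exact hns ⟨hJn.nonempty.preimage hsurj, hJc.nonempty.preimage hsurj, Or.inl hJ, hcon⟩
      obtain ⟨B, hB, hBJ⟩ := this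
      obtain ⟨⟨x, hx, hxJ⟩, ⟨y, hy, hyJ⟩, ⟨z, hz, hzJ⟩, ⟨t, ht, htJ⟩⟩ := crossing_iff.1 hBJ
      obtain ⟨J', rfl⟩ := hunion B fun w hw => by
        have hnc := ((hT _).1 ⟨w, v, hw, rfl⟩).not_crossing B hB
        by_contra! hcon
        obtain ⟨⟨b, hb, hbB⟩, ⟨c, hc, hcB⟩⟩ :=
          And.intro (Set.not_subset.1 hcon.1) (Set.not_subset.1 hcon.2)
        have hout : ∀ p q, f p ∈ J → f q ∉ J → p ∈ T.side w v → q ∉ T.side w v := by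
          intro p q hp hq hpw hqw
          rw [(hf p ⟨w, hw⟩).2 hpw] at hp
          rw [(hf q ⟨w, hw⟩).2 hqw] at hq
          exact hq hp
        refine hnc (crossing_iff.2 ⟨⟨c, not_not.1 hcB, hc⟩, ?_, ⟨b, hbB, hb⟩, ?_⟩)
        · by_cases h : x ∈ T.side w v
          · exact ⟨y, hy, hout x y hxJ hyJ h⟩
          · exact ⟨x, hx, h⟩
        · by_cases h : z ∈ T.side w v
          · exact ⟨t, ht, hout z t hzJ htJ h⟩
          · exact ⟨z, hz, h⟩
      exact ⟨J', hB, crossing_iff.2 ⟨⟨f x, hxJ, hx⟩, ⟨f z, hzJ, hz⟩, ⟨f y, hyJ, hy⟩,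
        ⟨f t, htJ, ht⟩⟩⟩
    obtain ⟨I, hAI⟩ := hunion A hbr
    have hIn : I.Nontrivial := by
      by_contra hn
      rcases (Set.not_nontrivial_iff.1 hn).eq_empty_or_singleton with rfl | ⟨i, rfl⟩
      · simp [hAI] at hAn
      · exact hE ⟨i, v, i.2, by rw [hAI, hpre]⟩
    have hIc : Iᶜ.Nontrivial := by
      by_contra hn
      rcases (Set.not_nontrivial_iff.1 hn).eq_empty_or_singleton with h | ⟨i, h⟩
      · rw [hAI, ← Set.preimage_compl, h] at hAc
        simp at hAc
      · refine hE (isEdgeSide_compl.1 ⟨i, v, i.2, ?_⟩)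
        rw [hAI, ← Set.preimage_compl, h, hpre]
    obtain ⟨h1, h2⟩ := (hF.preimage hsurj).structure_of_nontrivial (H := H) (I := I)
      (fun i => by
        simp only [hH, Set.mem_ofPred_eq, hpre, hpre']
        rw [← T.side_compl i.2]
        exact ((hT _).1 ⟨i, v, i.2, rfl⟩).mem_or)
      (fun A D hA hAD hD hAc => hc _ _ (hA.preimage hsurj) (Set.preimage_mono hAD) hD hAc)
      hcr (by rw [hH, Set.mem_ofPred_eq, ← hAI]; exact hA) hIn hIc
    set C : Set {w // T.graph.Adj w v} := {i | {i} ∈ H ∧ ¬ ∀ j, {j}ᶜ ∈ H ↔ j = i} with hC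
    have hch : T.children v = Subtype.val '' C := by
      ext w
      have harc' : ∀ i j : {w // T.graph.Adj w v}, (T.Arc v j ↔ (j : T.V) = i) ↔
          (({j}ᶜ : Set _) ∈ H ↔ j = i) := fun i j => by
        simp only [hH, Set.mem_ofPred_eq, hpre', harc, and_iff_right j.2.symm, Subtype.ext_iff]
      constructor
      · rintro ⟨hw, hn⟩
        refine ⟨⟨w, T.arc_adj _ _ hw⟩, ⟨?_, fun hall => hn fun z => ?_⟩, rfl⟩
        · simpa only [hH, Set.mem_ofPred_eq, hpre] using ((harc _ _).1 hw).2
        · by_cases hz : T.graph.Adj z v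
          · exact (harc' ⟨w, T.arc_adj _ _ hw⟩ ⟨z, hz⟩).2 (hall _)
          · refine iff_of_false (fun h => hz (T.arc_adj _ _ h).symm) ?_
            rintro rfl
            exact hz (T.arc_adj _ _ hw)
      · rintro ⟨i, ⟨hi, hn⟩, rfl⟩
        refine ⟨(harc _ _).2 ⟨i.2, ?_⟩, fun hall => hn fun j => (harc' i j).1 (hall _)⟩
        simpa only [hH, Set.mem_ofPred_eq, hpre] using hi
    have hbi : ∀ J : Set {w // T.graph.Adj w v},
        ⋃ w ∈ Subtype.val '' J, T.side w v = f ⁻¹' J := by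
      intro J
      rw [Set.biUnion_image]
      ext x
      simp only [Set.mem_iUnion, Set.mem_preimage, ← hf, exists_prop, exists_eq_right']
    refine ⟨v, hv, (hlabel v).2 ?_, Subtype.val '' I, hch ▸ Set.image_mono h1.1, ?_, ?_, ?_⟩
    · rintro B ⟨J, hJ, hJ1, -, rfl⟩
      rw [hch] at hJ
      obtain ⟨J', hJ', rfl⟩ := Set.subset_image_iff.1 hJ
      rw [hbi]
      refine h2 J' hJ' ?_
      rw [Set.ncard_image_of_injective _ Subtype.val_injective] at hJ1
      exact Set.nonempty_of_ncard_ne_zero (by omega)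
    · rw [Set.ncard_image_of_injective _ Subtype.val_injective]
      exact (Set.one_lt_ncard (Set.toFinite I)).2 hIn
    · rw [hch, Set.ncard_image_of_injective _ Subtype.val_injective,
        Set.ncard_image_of_injective _ Subtype.val_injective]
      exact Set.ncard_lt_ncard h1
    · rw [hbi, hAI]

/-- Direct the edges of a tree according to the family `F`. -/
def withArcs (T : DirectedTree X) (F : Set (Set X))
    (h : ∀ v w, T.graph.Adj v w → T.side v w ∈ F ∨ T.side w v ∈ F) : DirectedTree X :=
  { T with
    Arc := fun v w => T.graph.Adj v w ∧ T.side v w ∈ F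
    arc_adj := fun _ _ h => h.1
    adj_arc := fun v w hvw => (h v w hvw).imp (fun h => ⟨hvw, h⟩) fun h => ⟨hvw.symm, h⟩ }

open Classical in
/-- Label the nodes of a directed tree according to the family `F`. -/
noncomputable def withLabels (T : DirectedTree X) (F : Set (Set X)) : DirectedTree X :=
  { T with
    label := fun v =>
      if ∀ A, T.IsChildUnion v A → A ∈ F then NodeLabel.complete else NodeLabel.prime }

theorem withLabels_label_iff (T : DirectedTree X) (F : Set (Set X)) (v : T.V) :
    (T.withLabels F).label v = NodeLabel.complete ↔ ∀ A, T.IsChildUnion v A → A ∈ F := by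
  simp only [withLabels]
  split_ifs with hv
  · exact iff_of_true rfl hv
  · exact iff_of_false (by simp) hv

/-- A tree whose edges are the strong splits of `F` can be made a representation of `F`. -/
theorem exists_represents (hF : IsPartitiveCrossing F)
    (hc : ∀ A D : Set X, A.Nonempty → A ⊆ D → D ∈ F → Aᶜ ∈ F → Dᶜ ∈ F)
    (hT : ∀ A, T.IsEdgeSide A ↔ IsStrongSplit F A) :
    ∃ T' : DirectedTree X, T'.Represents F := by
  have h : ∀ v w, T.graph.Adj v w → T.side v w ∈ F ∨ T.side w v ∈ F := fun v w hvw => by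
    rw [← T.side_compl hvw]
    exact ((hT _).1 ⟨v, w, hvw, rfl⟩).mem_or
  -- Arcs come first because the children, and hence the labels, depend on them. Edge sides depend
  -- only on the graph and the leaves, so `hT` carries over.
  refine ⟨(T.withArcs F h).withLabels F, represents_of_isEdgeSide_iff hF hc hT
    (fun _ _ => Iff.rfl) fun v => (T.withArcs F h).withLabels_label_iff F v⟩

end DirectedTree

/-! ### Hasse diagrams of tree orders -/

namespace SimpleGraph

theorem exists_hasse_walk {α : Type*} [PartialOrder α] [Finite α] {u v : α} (h : u ≤ v) :
    ∃ p : (hasse α).Walk u v, ∀ z ∈ p.support, u ≤ z := by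
  induction u using WellFoundedGT.induction with
  | ind u ih =>
    rcases h.eq_or_lt with rfl | hlt
    · exact ⟨Walk.nil, by simp⟩
    · obtain ⟨c, huc, hcv⟩ := exists_covBy_le_of_lt hlt
      obtain ⟨p, hp⟩ := ih c huc.lt hcv
      refine ⟨Walk.cons (show (hasse α).Adj u c from Or.inl huc) p, fun z hz => ?_⟩
      rw [Walk.support_cons, List.mem_cons] at hz
      rcases hz with rfl | hz
      · exact le_rfl
      · exact huc.le.trans (hp z hz)

theorem covBy_unique {α : Type*} [PartialOrder α]
    (hα : ∀ a b c : α, a ≤ b → a ≤ c → b ≤ c ∨ c ≤ b) {u v w : α} (hv : u ⋖ v) (hw : u ⋖ w) : v = w := by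
  rcases hα u v w hv.le hw.le with h | h
  · exact (hw.eq_or_eq hv.le h).resolve_left hv.lt.ne'
  · exact ((hv.eq_or_eq hw.le h).resolve_left hw.lt.ne').symm

variable {α : Type*} [PartialOrder α] [OrderTop α] [Finite α]

theorem below_hasse_iff (hα : ∀ a b c : α, a ≤ b → a ≤ c → b ≤ c ∨ c ≤ b) {u v : α} :
    (hasse α).Below ⊤ u v ↔ u ≤ v := by
  constructor
  · intro h
    obtain ⟨p, hp⟩ := exists_hasse_walk (le_top : u ≤ ⊤)
    exact hp v (h p)
  · have key : ∀ (u b : α) (p : (hasse α).Walk u b), b = ⊤ → u ≤ v → v ∈ p.support := by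
      intro u b p hb
      induction p with
      | nil =>
        intro h
        subst hb
        simp [top_le_iff.1 h]
      | @cons u c b h p ih =>
        intro huv
        rw [Walk.support_cons, List.mem_cons]
        rcases huv.eq_or_lt with rfl | hlt
        · exact Or.inl rfl
        · refine Or.inr (ih hb ?_)
          rcases h with h | h
          · rcases hα u c v h.le huv with h' | h'
            · exact h'
            · exact ((h.eq_or_eq huv h').resolve_left hlt.ne').ge
          · exact h.le.trans huv
    exact fun h p => key u ⊤ p rfl h

theorem isTree_hasse (hα : ∀ a b c : α, a ≤ b → a ≤ c → b ≤ c ∨ c ≤ b) :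
    (hasse α).IsTree := by
  have hconn : (hasse α).Connected := by
    have : Nonempty α := ⟨⊤⟩
    refine ⟨fun u v => ?_⟩
    obtain ⟨p, -⟩ := exists_hasse_walk (le_top : u ≤ ⊤)
    obtain ⟨q, -⟩ := exists_hasse_walk (le_top : v ≤ ⊤)
    exact ⟨p.append q.reverse⟩
  refine ⟨hconn, isAcyclic_iff_forall_adj_isBridge.2 fun u v huv => ?_⟩
  -- A walk leaving the down-set of `u` does so along a cover relation, and by the chain condition
  -- this can only be the edge from `u` to its unique cover.
  have key : ∀ (u v : α), u ⋖ v → ∀ (z b : α) (p : (hasse α).Walk z b), z ≤ u → ¬ b ≤ u →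
      s(u, v) ∈ p.edges := by
    intro u v huv z b p
    induction p with
    | nil => exact fun h h' => absurd h h'
    | @cons z c b h p ih =>
      intro hz hb
      rw [Walk.edges_cons, List.mem_cons]
      by_cases hc : c ≤ u
      · exact Or.inr (ih hc hb)
      · have hzc : z ⋖ c := h.resolve_right fun h => hc (h.le.trans hz)
        have huc := (hα z c u hzc.le hz).resolve_left hc
        rcases hzc.eq_or_eq hz huc with rfl | rfl
        · exact Or.inl (by rw [covBy_unique hα huv hzc])
        · exact absurd le_rfl hc
  rw [isBridge_iff_forall_walk_mem_edges]
  rcases huv with h | h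
  · exact fun p => key u v h u v p le_rfl h.lt.not_ge
  · intro p
    have := key v u h v u p.reverse le_rfl h.lt.not_ge
    rwa [Walk.edges_reverse, List.mem_reverse, Sym2.eq_swap] at this

end SimpleGraph

namespace DirectedTree

open SimpleGraph

variable {X : Type u}

/-- The nodes of the tree of strong splits of `F`, rooted at the leaf `r`. -/
def SplitNode (F : Set (Set X)) (r : X) : Type u :=
  {A : Set X // A = Set.univ ∨ IsStrongSplit F A ∧ r ∉ A}

namespace SplitNode

variable {F : Set (Set X)} {r : X}

instance : PartialOrder (SplitNode F r) := Subtype.partialOrder _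

instance : OrderTop (SplitNode F r) where
  top := ⟨Set.univ, Or.inl rfl⟩
  le_top := fun a => Set.subset_univ a.1

instance [Finite X] : Finite (SplitNode F r) := Subtype.finite

theorem strong_of_ne {a : SplitNode F r} (h : a ≠ ⊤) : IsStrongSplit F a.1 ∧ r ∉ a.1 :=
  a.2.resolve_left fun e => h (Subtype.ext e)

theorem nonempty (a : SplitNode F r) : a.1.Nonempty := by
  by_cases h : a = ⊤
  · rw [h]
    exact ⟨r, Set.mem_univ r⟩
  · exact (strong_of_ne h).1.nonempty

theorem mem_iff_eq_top {a : SplitNode F r} : r ∈ a.1 ↔ a = ⊤ := by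
  refine ⟨fun h => ?_, fun h => h ▸ Set.mem_univ r⟩
  by_contra hne
  exact (strong_of_ne hne).2 h

/-- Neither set crosses the other, they share `x`, and for proper ones `r` lies outside both; the
only possibility left is inclusion. -/
theorem le_or_le_of_mem {b c : SplitNode F r} {x : X} (hb : x ∈ b.1) (hc : x ∈ c.1) :
    b ≤ c ∨ c ≤ b := by
  by_cases hbt : b = ⊤
  · exact Or.inr (hbt ▸ le_top)
  by_cases hct : c = ⊤
  · exact Or.inl (hct ▸ le_top)
  obtain ⟨hb1, hb2⟩ := strong_of_ne hbt
  obtain ⟨hc1, hc2⟩ := strong_of_ne hct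
  have hnc : ¬ Crossing b.1 c.1 := by
    rcases hb1.mem_or with h | h
    · exact hc1.not_crossing _ h
    · exact fun hcr => hc1.not_crossing _ h (crossing_compl_left.2 hcr)
  by_contra! hcon
  obtain ⟨⟨y, hy, hyc⟩, ⟨z, hz, hzb⟩⟩ :=
    And.intro (Set.not_subset.1 hcon.1) (Set.not_subset.1 hcon.2)
  exact hnc (crossing_iff.2 ⟨⟨x, hb, hc⟩, ⟨y, hy, hyc⟩, ⟨z, hzb, hz⟩, ⟨r, hb2, hc2⟩⟩)

theorem chain (a b c : SplitNode F r) (hb : a ≤ b) (hc : a ≤ c) : b ≤ c ∨ c ≤ b := by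
  obtain ⟨x, hx⟩ := a.nonempty
  exact le_or_le_of_mem (hb hx) (hc hx)

theorem isStrongSplit_singleton (hF : ∀ x, {x} ∈ F) {x : X} (hx : x ≠ r) :
    IsStrongSplit F {x} where
  nonempty := Set.singleton_nonempty x
  compl_nonempty := ⟨r, hx.symm⟩
  mem_or := Or.inl (hF x)
  not_crossing := fun _ _ hc => Set.not_nontrivial_singleton hc.symm.1.left_nontrivial

open Classical in
/-- The leaves of the tree of strong splits. -/
noncomputable def leaf (hF : ∀ x, {x} ∈ F) (r x : X) : SplitNode F r :=
  if hx : x = r then ⊤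
  else ⟨{x}, Or.inr ⟨isStrongSplit_singleton hF hx, fun h => hx h.symm⟩⟩

variable (hF : ∀ x, {x} ∈ F)

theorem leaf_self : leaf hF r r = ⊤ := dif_pos rfl

theorem val_leaf {x : X} (hx : x ≠ r) : (leaf hF r x).1 = {x} :=
  congrArg Subtype.val (dif_neg hx)

theorem leaf_le_iff {x : X} {a : SplitNode F r} : leaf hF r x ≤ a ↔ x ∈ a.1 := by
  by_cases hx : x = r
  · subst hx
    rw [leaf_self, top_le_iff, mem_iff_eq_top]
  · change (leaf hF r x).1 ⊆ a.1 ↔ _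
    rw [val_leaf hF hx, Set.singleton_subset_iff]

theorem leaf_injective : Function.Injective (leaf hF r) := by
  intro x y h
  by_cases hx : x = r
  · subst hx
    rw [leaf_self, eq_comm, ← mem_iff_eq_top] at h
    by_contra hne
    rw [val_leaf hF (Ne.symm hne)] at h
    exact hne h
  · have h1 := (leaf_le_iff hF).1 h.le
    have h2 := (leaf_le_iff hF).1 h.ge
    rw [val_leaf hF hx] at h2
    exact Eq.symm h2

theorem eq_leaf_of_le [Finite X] {x : X} (hx : x ≠ r) {c : SplitNode F r}
    (h : c ≤ leaf hF r x) : c = leaf hF r x := by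
  have hs : c.1 ⊆ {x} := by
    rw [← val_leaf hF hx]
    exact h
  refine h.antisymm ((leaf_le_iff hF).2 ?_)
  obtain ⟨y, hy⟩ := c.nonempty
  have : y = x := hs hy
  exact this ▸ hy

theorem ncard_neighborSet_leaf_le [Finite X] (x : X) :
    ((hasse (SplitNode F r)).neighborSet (leaf hF r x)).ncard ≤ 1 := by
  rw [Set.ncard_le_one (Set.toFinite _)]
  by_cases hx : x = r
  · subst hx
    -- The root is itself a leaf: the complement of the root leaf is a strong split containing every
    -- other proper node, hence the only possible neighbour.
    have key : ∀ c ∈ (hasse (SplitNode F x)).neighborSet (leaf hF x x), c.1 = {x}ᶜ := by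
      intro c hc
      rw [leaf_self] at hc
      have hc : c ⋖ ⊤ := hc.resolve_left fun h => not_top_lt h.lt
      obtain ⟨hs, hxc⟩ := strong_of_ne hc.lt.ne
      have hsub : c.1 ⊆ {x}ᶜ := fun y hy e => hxc (e ▸ hy)
      let d : SplitNode F x := ⟨{x}ᶜ, Or.inr ⟨⟨hs.nonempty.mono hsub, by simp,
        Or.inr (by simpa using hF x), fun B _ hB => Set.not_nontrivial_singleton
          (crossing_compl_right.1 hB).symm.1.left_nontrivial⟩, by simp⟩⟩
      have hd : d ≠ ⊤ := fun e => (show x ∉ d.1 by simp [d]) (e ▸ Set.mem_univ x)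
      have := (hc.eq_or_eq (show c ≤ d from hsub) le_top).resolve_right hd
      exact congrArg Subtype.val this.symm
    exact fun a ha b hb => Subtype.ext ((key a ha).trans (key b hb).symm)
  · have key : ∀ c ∈ (hasse (SplitNode F r)).neighborSet (leaf hF r x), leaf hF r x ⋖ c :=
      fun c hc => hc.resolve_right fun h => h.lt.ne (eq_leaf_of_le hF hx h.le)
    exact fun a ha b hb => covBy_unique chain (key a ha) (key b hb)

theorem three_le_ncard_neighborSet [Finite X] {a : SplitNode F r}
    (ha : a ∉ Set.range (leaf hF r)) : 3 ≤ ((hasse (SplitNode F r)).neighborSet a).ncard := by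
  have hat : a ≠ ⊤ := fun e => ha ⟨r, by rw [e, leaf_self]⟩
  have hlt : ∀ x ∈ a.1, leaf hF r x < a := fun x hx =>
    ((leaf_le_iff hF).2 hx).lt_of_ne fun e => ha ⟨x, e⟩
  obtain ⟨p, hp, -⟩ := exists_covBy_le_of_lt (lt_top_iff_ne_top.2 hat)
  obtain ⟨x, hx⟩ := a.nonempty
  obtain ⟨c, hxc, hc⟩ := exists_le_covBy_of_lt (hlt x hx)
  obtain ⟨y, hya, hyc⟩ := Set.not_subset.1 (show ¬ a.1 ⊆ c.1 from hc.lt.not_ge)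
  obtain ⟨d, hyd, hd⟩ := exists_le_covBy_of_lt (hlt y hya)
  -- The parent, and two children: one above the leaf `x`, another above a leaf `y` that the first
  -- child misses.
  refine (Set.two_lt_ncard_iff (Set.toFinite _)).2 ⟨p, c, d, Or.inl hp, Or.inr hc, Or.inr hd,
    (hc.lt.trans hp.lt).ne', (hd.lt.trans hp.lt).ne', ?_⟩
  rintro rfl
  exact hyc ((leaf_le_iff hF).1 hyd)

end SplitNode

/-- The tree of strong splits of `F`. -/
noncomputable def splitTree [Finite X] {F : Set (Set X)} (hF : ∀ x, {x} ∈ F) (r : X) :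
    DirectedTree X where
  V := SplitNode F r
  finite := inferInstance
  graph := hasse (SplitNode F r)
  isTree := isTree_hasse SplitNode.chain
  leaf := SplitNode.leaf hF r
  leaf_injective := SplitNode.leaf_injective hF
  leaf_degree := SplitNode.ncard_neighborSet_leaf_le hF
  internal_degree := fun _ => SplitNode.three_le_ncard_neighborSet hF
  -- Arcs and labels are placeholders, replaced in `exists_represents`.
  Arc := (hasse (SplitNode F r)).Adj
  arc_adj := fun _ _ h => h
  adj_arc := fun _ _ h => Or.inl h
  label := fun _ => NodeLabel.prime

theorem isEdgeSide_splitTree_iff [Finite X] {F : Set (Set X)} (hF : ∀ x, {x} ∈ F) (r : X)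
    (A : Set X) : (splitTree hF r).IsEdgeSide A ↔ IsStrongSplit F A := by
  have hcl : ∀ a : SplitNode F r, (splitTree hF r).cluster (⊤ : SplitNode F r) a = a.1 := by
    intro a
    ext x
    exact (below_hasse_iff SplitNode.chain).trans (SplitNode.leaf_le_iff hF)
  rw [isEdgeSide_iff_cluster (T := splitTree hF r) (⊤ : SplitNode F r)]
  constructor
  · rintro ⟨a, ha, h⟩
    have hs := (SplitNode.strong_of_ne ha).1
    rw [hcl a] at h
    rcases h with rfl | rfl
    · exact hs
    · exact hs.compl
  · intro h
    have key : ∀ B : Set X, IsStrongSplit F B → r ∉ B → ∃ a : SplitNode F r, a ≠ ⊤ ∧ a.1 = B :=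
      fun B hB hr => ⟨⟨B, Or.inr ⟨hB, hr⟩⟩, fun e =>
        hr ((show B = Set.univ from congrArg Subtype.val e) ▸ Set.mem_univ r), rfl⟩
    by_cases hr : r ∈ A
    · obtain ⟨a, ha, e⟩ := key Aᶜ h.compl (fun h => h hr)
      exact ⟨a, ha, Or.inr (by rw [hcl a, e, compl_compl])⟩
    · obtain ⟨a, ha, e⟩ := key A h hr
      exact ⟨a, ha, Or.inl (by rw [hcl a, e])⟩

/-! ### The size of a tree -/

theorem card_le [Finite X] [Nonempty X] (T : DirectedTree X) : Nat.card T.V ≤ 2 * Nat.card X := by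
  classical
  have := T.finite
  have := Fintype.ofFinite T.V
  have := Fintype.ofFinite X
  have hX : 0 < Nat.card X := Nat.card_pos
  rcases subsingleton_or_nontrivial T.V with h | h
  · have : Nat.card T.V ≤ 1 := Finite.card_le_one_iff_subsingleton.2 h
    omega
  have hdeg : ∀ v, (T.graph.neighborSet v).ncard = T.graph.degree v := fun v => by
    rw [Set.ncard_eq_toFinset_card', ← card_neighborFinset_eq_degree]
    rfl
  -- Summing over the `n` nodes gives `3 * n ≤ 2 * (n - 1) + 2 * Nat.card X`. A leaf has degree at
  -- least one because the tree has more than one node.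
  have h1 : ∀ v, 3 ≤ T.graph.degree v + if v ∈ Set.range T.leaf then 2 else 0 := by
    intro v
    split_ifs with hv
    · have := T.isTree.connected.preconnected.degree_pos_of_nontrivial v
      omega
    · exact hdeg v ▸ T.internal_degree v hv
  have h2 := Finset.sum_le_sum fun v (_ : v ∈ Finset.univ) => h1 v
  rw [Finset.sum_add_distrib, T.graph.sum_degrees_eq_twice_card_edges, ← Finset.sum_filter,
    Finset.sum_const, Finset.sum_const, smul_eq_mul, smul_eq_mul, Finset.card_univ] at h2
  have h3 := T.isTree.card_edgeFinset
  have h4 : (Finset.univ.filter fun v => v ∈ Set.range T.leaf).card = Nat.card X := by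
    rw [show (Finset.univ.filter fun v => v ∈ Set.range T.leaf) = Finset.univ.image T.leaf by
      ext v; simp, Finset.card_image_of_injective _ T.leaf_injective, Finset.card_univ,
      Nat.card_eq_fintype_card]
  rw [Nat.card_eq_fintype_card (α := T.V)]
  omega

theorem size_le [Finite X] [Nonempty X] (T : DirectedTree X) : T.size ≤ 6 * Nat.card X := by
  classical
  have := T.finite
  have := Fintype.ofFinite T.V
  have h1 := T.card_le
  have h2 := T.isTree.card_edgeFinset
  -- There are at most two arcs per edge and fewer edges than nodes, so the arcs number at most `4 *
  -- Nat.card X`.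
  have h3 : {a : T.V × T.V | T.Arc a.1 a.2}.ncard ≤ Fintype.card T.graph.Dart := by
    refine (Set.ncard_le_ncard (t := Set.range fun d : T.graph.Dart => d.toProd)
      (fun a ha => ⟨⟨a, T.arc_adj _ _ ha⟩, rfl⟩) (Set.toFinite _)).trans ?_
    rw [← Set.image_univ, ← Nat.card_eq_fintype_card, ← Set.ncard_univ]
    exact Set.ncard_image_le (Set.toFinite _)
  rw [dart_card_eq_twice_card_edges] at h3
  rw [size]
  rw [Nat.card_eq_fintype_card] at h1 ⊢
  omega

end DirectedTree

theorem mainTheorem1 {X : Type u} [Finite X] [Nonempty X] (G : TwoStructure X)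
    (K : Set ℕ) (hK : ∀ x y, x ≠ y → G.E x y ∈ K)
    (I : K → K) (hI : Function.Involutive I) (hfix : ∀ i, I i ≠ i) :
    IsPartitiveCrossing (G.involutionModules I) ∧
      ∃ T : DirectedTree X, T.Represents (G.involutionModules I) ∧
        T.size ≤ 6 * Nat.card X ∧
        ∀ T' : DirectedTree X, T'.Represents (G.involutionModules I) → T.IsIsomorphic T' := by
  have hF := G.isPartitiveCrossing_involutionModules hK hI hfix
  obtain ⟨r⟩ := ‹Nonempty X›
  obtain ⟨T, hT⟩ := DirectedTree.exists_represents
    (T := DirectedTree.splitTree (G.singleton_mem_involutionModules I) r) hF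
    (fun _ _ => G.compl_mem_involutionModules hK hI)
    (DirectedTree.isEdgeSide_splitTree_iff _ r)
  have : Nonempty X := ⟨r⟩
  exact ⟨hF, T, hT, T.size_le, fun T' hT' => hT.isIsomorphic hT'⟩
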